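/- Let $n\ge 2$ be an integer. For a real algebraic number $\alpha$, let $p\in\mathbb{Z}[x]$ be its minimal polynomial over $\mathbb{Z}$, i.e. a nonzero integer polynomial of least degree with $p(\alpha)=0$ whose coefficients have greatest common divisor $1$ (it is unique up to sign). The degree $\deg(\alpha)$ is the degree of $p$, and the height $H(\alpha)$ is the maximum of the absolute values of the coefficients of $p$. For $S\subseteq\mathbb{R}$ and real $Q$, let $\Phi_n(Q,S)$ be the number of real algebraic numbers $\alpha\in S$ with $\deg(\alpha)=n$ and $H(\alpha)\le Q$. Put $\ell(2)=1$ and $\ell(n)=0$ for $n\ge 3$. For every $x\in\mathbb{R}$ the limit $$F_n(x)=\lim_{Q\to\infty}\frac{\Phi_n(Q,(-\infty,x])}{\Phi_n(Q,\mathbb{R})}$$ exists, the function $F_n$ is differentiable on $\mathbb{R}$, and the distribution density $\rho_n=F_n'$ is integrable on $\mathbb{R}$. Moreover, there is a constant $C$ depending only on $n$ with the following property. Let $(\alpha_i)_{i=1}^\infty$ be any sequence that contains every real algebraic number of degree $n$ exactly once and satisfies $H(\alpha_i)\le H(\alpha_{i+1})$ for all $i\ge 1$. Then for every interval $I\subseteq\mathbb{R}$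 (bounded or unbounded, with or without its endpoints) and every integer $N\ge 2$, $$\left|\#\{1\le i\le N:\alpha_i\in I\}-N\int_I\rho_n(x)\,dx\right|\le C\,N^{\frac{n}{n+1}}(\ln N)^{\ell(n)}.$$ -/

import Mathlib

open Polynomial Filter Topology

namespace RealAlgDist

/-- The naive height `H(p) = max |a_i|` of an integer polynomial. -/
def polyHeight (p : ℤ[X]) : ℕ := p.support.sup fun i => (p.coeff i).natAbs

/-- `p` is a minimal polynomial over `ℤ` of the real number `x`: a nonzero integer polynomial
vanishing at `x`, of least degree among all such, whose coefficients have gcd `1`.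
Such a `p` is unique up to sign. -/
structure IsIntMinpoly (p : ℤ[X]) (x : ℝ) : Prop where
  ne_zero : p ≠ 0
  root : aeval x p = 0
  minimal : ∀ q : ℤ[X], q ≠ 0 → aeval x q = 0 → p.natDegree ≤ q.natDegree
  primitive : p.IsPrimitive

open Classical in
/-- A minimal polynomial over `ℤ` of an algebraic `x`; the choice of the sign affects neither its
degree nor its height. (The value is `0` when `x` is transcendental.) -/
noncomputable def intMinpoly (x : ℝ) : ℤ[X] :=
  if h : ∃ p, IsIntMinpoly p x then h.choose else 0

/-- The degree of an algebraic number. -/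
noncomputable def degree (x : ℝ) : ℕ := (intMinpoly x).natDegree

/-- The height of an algebraic number. -/
noncomputable def height (x : ℝ) : ℕ := polyHeight (intMinpoly x)

/-- The real algebraic numbers of degree `n`. -/
def algNumbers (n : ℕ) : Set ℝ := {x | IsAlgebraic ℤ x ∧ degree x = n}

/-- The real algebraic numbers of degree `n` and height at most `Q`. -/
def algNumbersLE (n : ℕ) (Q : ℝ) : Set ℝ := {x ∈ algNumbers n | (height x : ℝ) ≤ Q}

/-- The counting function `Φ_n(Q, S)`. -/
noncomputable def countingFunction (n : ℕ) (Q : ℝ) (S : Set ℝ) : ℕ := (algNumbersLE n Q ∩ S).ncard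

/-- The proportion `Φ_n(Q, (-∞, x]) / Φ_n(Q, ℝ)`. -/
noncomputable def proportion (n : ℕ) (x Q : ℝ) : ℝ :=
  (countingFunction n Q (Set.Iic x) : ℝ) / (countingFunction n Q Set.univ : ℝ)

/-- The distribution function `F_n(x) = lim_{Q → ∞} Φ_n(Q, (-∞, x]) / Φ_n(Q, ℝ)`. -/
noncomputable def distributionFunction (n : ℕ) (x : ℝ) : ℝ := limUnder atTop (proportion n x)

/-- The distribution density `ρ_n = F_n'`. -/
noncomputable def distributionDensity (n : ℕ) : ℝ → ℝ := deriv (distributionFunction n)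

/-- The exponent `ℓ(n)` of the logarithm, for `n ≥ 2`. -/
def ell (n : ℕ) : ℕ := if n = 2 then 1 else 0

/-- `α 0, α 1, …` lists every real algebraic number of degree `n` exactly once,
by non-decreasing height. -/
structure IsHeightOrdering (n : ℕ) (α : ℕ → ℝ) : Prop where
  injective : Function.Injective α
  range_eq : Set.range α = algNumbers n
  height_le : ∀ i, height (α i) ≤ height (α (i + 1))

/-- The number of the first `N` terms of the sequence that lie in `S`. -/
noncomputable def countFirst (α : ℕ → ℝ) (N : ℕ) (S : Set ℝ) : ℕ := {i : ℕ | i < N ∧ α i ∈ S}.ncard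

end RealAlgDist

/-!
A real number of degree `n` has two minimal polynomials `±p`, so up to a factor `2` the numbers
counted by `Φ_n(Q, I)` are the roots in `I` of the irreducible primitive integer polynomials of
degree `n` and height at most `Q`.

The number of roots in `I` of a real polynomial is a function of its coefficient vector. When a
single coefficient varies, say in `h + t X ^ k`, this function is a sum of boundedly many indicator
functions of intervals: a root `x` determines `t = -h(x) / x ^ k`, which is monotone between
consecutive critical points. Summing over the integer points of a cube one coordinate at a time
therefore gives its integral over the cube up to `O(Q ^ n)`, uniformly in `I`, and Möbius inversion
restricts the sum to primitive vectors. The reducible polynomials among them are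
`O(Q ^ n (log Q) ^ ℓ(n))` in number, because by Gelfond's inequality the heights of the factors
multiply up to a constant.

Hence `Φ_n(Q, I) = c(I) Q ^ (n + 1) + O(Q ^ n (log Q) ^ ℓ(n))`. The area formula in the constant
coefficient writes `c(I)` as the integral over `I` of a continuous density. Finally, if `Q` is the
height of `α_N`, then the first `N` terms contain all numbers of height below `Q` and none of height
above `Q`, so `N` is `c(ℝ) Q ^ (n + 1)` up to the same error.
-/

namespace RealAlgDist

open MeasureTheory Set
open scoped Classical Pointwise

section ofFn

variable {R : Type*} [DecidableEq R] {m : ℕ}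

lemma ofFn_coeff_fin [Semiring R] (a : Fin m → R) (j : Fin m) : (ofFn m a).coeff j = a j :=
  ofFn_coeff_eq_val_of_lt a j.2

lemma ofFn_eq_zero_iff [Semiring R] {a : Fin m → R} : ofFn m a = 0 ↔ a = 0 :=
  map_eq_zero_iff _ (injective_ofFn m)

lemma ofFn_map [Semiring R] {S : Type*} [Semiring S] [DecidableEq S] (f : R →+* S)
    (a : Fin m → R) : (ofFn m a).map f = ofFn m fun i => f (a i) := by
  simp [ofFn_eq_sum_monomial, Polynomial.map_sum]

lemma ofFn_eval [Semiring R] (a : Fin m → R) (x : R) :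
    (ofFn m a).eval x = ∑ i : Fin m, a i * x ^ (i : ℕ) := by
  simp [ofFn_eq_sum_monomial, eval_finsetSum]

lemma ofFn_smul [Semiring R] (c : R) (a : Fin m → R) : ofFn m (c • a) = C c * ofFn m a := by
  rw [map_smul, smul_eq_C_mul]

lemma ofFn_update [Semiring R] (a : Fin m → R) (k : Fin m) (t : R) :
    ofFn m (Function.update a k t) = ofFn m (Function.update a k 0) + monomial k t := by
  have hsplit : Function.update a k t = Function.update a k 0 + Pi.single k t := by
    rw [Pi.single, ← Function.update_add, add_zero, zero_add]
  rw [hsplit, map_add, ofFn_eq_sum_monomial (Pi.single k t), Fintype.sum_eq_single k]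
  · simp
  · intro i hi; simp [hi]

lemma ofFn_cons [Semiring R] (t : R) (b : Fin m → R) :
    ofFn (m + 1) (Fin.cons t b : Fin (m + 1) → R) = X * ofFn m b + C t := by
  simp only [ofFn_eq_sum_monomial, Fin.sum_univ_succ, Fin.cons_zero, Fin.cons_succ, Fin.val_zero,
    Fin.val_succ, monomial_zero_left, Finset.mul_sum, X_mul_monomial]
  rw [add_comm]

lemma ofFn_natDegree_lt_of_ne_zero [Semiring R] {a : Fin m → R} (ha : a ≠ 0) :
    (ofFn m a).natDegree < m :=
  ofFn_natDegree_lt (Nat.one_le_iff_ne_zero.2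
    (ne_zero_of_ofFn_ne_zero (ofFn_eq_zero_iff.not.2 ha))) a

end ofFn

/-- The number of distinct roots of `p` in `I`; it is `0` for `p = 0`, since `roots 0 = 0`. -/
noncomputable def rootCount (I : Set ℝ) (p : ℝ[X]) : ℕ :=
  (p.roots.toFinset.filter (· ∈ I)).card

lemma rootCount_zero (I : Set ℝ) : rootCount I 0 = 0 := by simp [rootCount]

lemma mem_filter_roots {I : Set ℝ} {p : ℝ[X]} (hp : p ≠ 0) {x : ℝ} :
    x ∈ p.roots.toFinset.filter (· ∈ I) ↔ x ∈ I ∧ p.eval x = 0 := by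
  simp [hp, and_comm]

lemma rootCount_le (I : Set ℝ) (p : ℝ[X]) : rootCount I p ≤ p.natDegree :=
  (Finset.card_filter_le _ _).trans ((Multiset.toFinset_card_le _).trans (card_roots' p))

lemma rootCount_C_mul (I : Set ℝ) {c : ℝ} (hc : c ≠ 0) (p : ℝ[X]) :
    rootCount I (C c * p) = rootCount I p := by
  rw [rootCount, rootCount, roots_C_mul p hc]

lemma rootCount_ofFn_le (I : Set ℝ) {m : ℕ} (a : Fin m → ℝ) : rootCount I (ofFn m a) ≤ m := by
  rcases eq_or_ne a 0 with rfl | ha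
  · simp [rootCount_zero]
  · exact (rootCount_le I _).trans (ofFn_natDegree_lt_of_ne_zero ha).le

lemma rootCount_ofFn_smul (I : Set ℝ) {m : ℕ} {c : ℝ} (hc : c ≠ 0) (a : Fin m → ℝ) :
    rootCount I (ofFn m (c • a)) = rootCount I (ofFn m a) := by
  rw [ofFn_smul, rootCount_C_mul I hc]

/-! ### Lattice points in intervals -/

lemma exists_Ioo_subset_subset_Icc {U : Set ℝ} (hU : U.OrdConnected) (hne : U.Nonempty)
    (hbdd : Bornology.IsBounded U) : ∃ a b, a ≤ b ∧ Ioo a b ⊆ U ∧ U ⊆ Icc a b := by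
  have hbb := hbdd.bddBelow
  have hba := hbdd.bddAbove
  exact ⟨sInf U, sSup U, csInf_le_csSup hne hbb hba,
    IsConnected.Ioo_csInf_csSup_subset ⟨hne, isPreconnected_iff_ordConnected.2 hU⟩ hbb hba,
    subset_Icc_csInf_csSup hbb hba⟩

lemma volume_real_eq_of_Ioo_subset_of_subset_Icc {U : Set ℝ} {a b : ℝ} (hab : a ≤ b)
    (hIoo : Ioo a b ⊆ U) (hIcc : U ⊆ Icc a b) : volume.real U = b - a := by
  have hvol : volume U = ENNReal.ofReal (b - a) :=
    le_antisymm ((measure_mono hIcc).trans_eq Real.volume_Icc)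
      (Real.volume_Ioo.symm.trans_le (measure_mono hIoo))
  rw [measureReal_def, hvol, ENNReal.toReal_ofReal (sub_nonneg.2 hab)]

lemma abs_ncard_int_sub_volume_le {U : Set ℝ} (hU : U.OrdConnected)
    (hbdd : Bornology.IsBounded U) :
    |(((↑) ⁻¹' U : Set ℤ).ncard : ℝ) - volume.real U| ≤ 1 := by
  rcases U.eq_empty_or_nonempty with rfl | hne
  · simp
  obtain ⟨a, b, hab, hIoo, hIcc⟩ := exists_Ioo_subset_subset_Icc hU hne hbdd
  rw [volume_real_eq_of_Ioo_subset_of_subset_Icc hab hIoo hIcc]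
  have hsub : ((↑) ⁻¹' U : Set ℤ) ⊆ Icc ⌈a⌉ ⌊b⌋ :=
    (preimage_mono hIcc).trans_eq Int.preimage_Icc
  have hsup : Ioo ⌊a⌋ ⌈b⌉ ⊆ ((↑) ⁻¹' U : Set ℤ) :=
    Int.preimage_Ioo.symm.trans_subset (preimage_mono hIoo)
  have hle := ncard_le_ncard hsub (finite_Icc _ _)
  have hge := ncard_le_ncard hsup ((finite_Icc _ _).subset hsub)
  rw [← Finset.coe_Icc, ncard_coe_finset, Int.card_Icc] at hle
  rw [← Finset.coe_Ioo, ncard_coe_finset, Int.card_Ioo] at hge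
  have hge' : ((⌈b⌉ : ℤ) : ℝ) - ⌊a⌋ - 1 ≤ ((↑) ⁻¹' U : Set ℤ).ncard := by
    exact_mod_cast (Int.self_le_toNat _).trans (Int.ofNat_le.2 hge)
  have hle' : ((((↑) ⁻¹' U : Set ℤ).ncard : ℤ) : ℝ) ≤ max (((⌊b⌋ : ℤ) : ℝ) + 1 - ⌈a⌉) 0 := by
    exact_mod_cast (Int.ofNat_le.2 hle).trans_eq (Int.toNat_eq_max _)
  have hmax : max (((⌊b⌋ : ℤ) : ℝ) + 1 - ⌈a⌉) 0 ≤ b - a + 1 :=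
    max_le (by linarith [Int.le_ceil a, Int.floor_le b]) (by linarith)
  rw [abs_le]
  constructor
  · linarith [Int.floor_le a, Int.le_ceil b]
  · exact sub_le_iff_le_add'.2 (by exact_mod_cast hle'.trans hmax)

/-- The integers in `[-Q, Q]`. -/
noncomputable def intIcc (Q : ℝ) : Finset ℤ := Finset.Icc ⌈-Q⌉ ⌊Q⌋

lemma mem_intIcc {Q : ℝ} {t : ℤ} : t ∈ intIcc Q ↔ |(t : ℝ)| ≤ Q := by
  rw [intIcc, Finset.mem_Icc, Int.ceil_le, Int.le_floor, abs_le]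

lemma card_intIcc_le {Q : ℝ} (hQ : 1 ≤ Q) : ((intIcc Q).card : ℝ) ≤ 3 * Q := by
  have hcard : ((intIcc Q).card : ℤ) = ⌊Q⌋ + 1 + ⌊Q⌋ := by
    have hfloor : 0 ≤ ⌊Q⌋ := Int.floor_nonneg.2 (by linarith)
    rw [intIcc, Int.card_Icc, Int.ceil_neg]
    omega
  have hcard' : ((intIcc Q).card : ℝ) = ⌊Q⌋ + 1 + ⌊Q⌋ := by exact_mod_cast hcard
  linarith [Int.floor_le Q]

/-- The error made in replacing the integral of `g` over `[-Q, Q]` by the sum over the integers in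
that interval. -/
noncomputable def latticeDiscrepancy (Q : ℝ) (g : ℝ → ℝ) : ℝ :=
  ∑ t ∈ intIcc Q, g t - ∫ t in Icc (-Q) Q, g t

lemma latticeDiscrepancy_add (Q : ℝ) {f g : ℝ → ℝ} (hf : IntegrableOn f (Icc (-Q) Q))
    (hg : IntegrableOn g (Icc (-Q) Q)) :
    latticeDiscrepancy Q (fun t => f t + g t) =
      latticeDiscrepancy Q f + latticeDiscrepancy Q g := by
  simp only [latticeDiscrepancy]
  rw [integral_add hf hg, Finset.sum_add_distrib, add_sub_add_comm]

lemma latticeDiscrepancy_sum {ι : Type*} (s : Finset ι) (Q : ℝ) {g : ι → ℝ → ℝ}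
    (hg : ∀ i ∈ s, IntegrableOn (g i) (Icc (-Q) Q)) :
    latticeDiscrepancy Q (fun t => ∑ i ∈ s, g i t) = ∑ i ∈ s, latticeDiscrepancy Q (g i) := by
  simp only [latticeDiscrepancy]
  rw [integral_finsetSum _ hg, Finset.sum_comm, Finset.sum_sub_distrib]

lemma integrableOn_indicator_one {T : Set ℝ} (hT : T.OrdConnected) (Q : ℝ) :
    IntegrableOn (T.indicator (1 : ℝ → ℝ)) (Icc (-Q) Q) :=
  Integrable.indicator (integrableOn_const (by simp)) hT.measurableSet

lemma abs_latticeDiscrepancy_indicator_le {T : Set ℝ} (hT : T.OrdConnected) (Q : ℝ) :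
    |latticeDiscrepancy Q (T.indicator 1)| ≤ 1 := by
  have hsum : ∑ t ∈ intIcc Q, T.indicator (1 : ℝ → ℝ) t =
      ((↑) ⁻¹' (T ∩ Icc (-Q) Q) : Set ℤ).ncard := by
    have hset : ((↑) ⁻¹' (T ∩ Icc (-Q) Q) : Set ℤ) = (intIcc Q).filter ((↑· : ℤ → ℝ) · ∈ T) := by
      ext t
      rw [Finset.mem_coe, Finset.mem_filter, mem_intIcc, abs_le, and_comm]
      rfl
    rw [hset, ncard_coe_finset, Finset.card_filter]
    push_cast
    rfl
  have hint : ∫ t in Icc (-Q) Q, T.indicator (1 : ℝ → ℝ) t = volume.real (T ∩ Icc (-Q) Q) := by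
    rw [integral_indicator_one hT.measurableSet, measureReal_restrict_apply hT.measurableSet]
  rw [latticeDiscrepancy, hsum, hint]
  exact abs_ncard_int_sub_volume_le (hT.inter ordConnected_Icc)
    ((Metric.isBounded_Icc _ _).subset inter_subset_right)

lemma abs_latticeDiscrepancy_sum_indicator_le {ι : Type*} (s : Finset ι) {T : ι → Set ℝ}
    (hT : ∀ i ∈ s, (T i).OrdConnected) (Q : ℝ) :
    |latticeDiscrepancy Q (fun t => ∑ i ∈ s, (T i).indicator 1 t)| ≤ s.card := by
  rw [latticeDiscrepancy_sum _ _ fun i hi => integrableOn_indicator_one (hT i hi) Q]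
  calc |∑ i ∈ s, latticeDiscrepancy Q ((T i).indicator 1)|
      ≤ ∑ i ∈ s, |latticeDiscrepancy Q ((T i).indicator 1)| := Finset.abs_sum_le_sum_abs _ _
    _ ≤ ∑ _i ∈ s, (1 : ℝ) :=
        Finset.sum_le_sum fun i hi => abs_latticeDiscrepancy_indicator_le (hT i hi) Q
    _ = s.card := by simp

/-! ### Intervals of monotonicity -/

/-- The points outside the finite set `Z` that have exactly `j` elements of `Z` to their left; for
`j ≤ #Z` these are the open intervals into which `Z` cuts the line. -/
def gap {α : Type*} [LinearOrder α] (Z : Finset α) (j : ℕ) : Set α :=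
  {x | x ∉ Z ∧ (Z.filter (· < x)).card = j}

section gap

variable {α : Type*} [LinearOrder α]

lemma gap_ordConnected (Z : Finset α) (j : ℕ) : (gap Z j).OrdConnected := by
  refine ⟨fun x hx y hy u ⟨hxu, huy⟩ => ?_⟩
  have hle : ∀ {v w : α}, v ≤ w → Z.filter (· < v) ⊆ Z.filter (· < w) := fun h =>
    Finset.monotone_filter_right _ fun _ _ hz => lt_of_lt_of_le hz h
  have hcard : (Z.filter (· < u)).card = j :=
    le_antisymm ((Finset.card_le_card (hle huy)).trans hy.2.le)
      (hx.2.ge.trans (Finset.card_le_card (hle hxu)))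
  refine ⟨fun huZ => ?_, hcard⟩
  have huy' : u < y := lt_of_le_of_ne huy fun h => hy.1 (h ▸ huZ)
  have hfilter : Z.filter (· < u) = Z.filter (· < y) :=
    Finset.eq_of_subset_of_card_le (hle huy) (hy.2.trans hcard.symm).le
  have hu : u ∈ Z.filter (· < u) := hfilter ▸ Finset.mem_filter.2 ⟨huZ, huy'⟩
  exact lt_irrefl u (Finset.mem_filter.1 hu).2

lemma iUnion_gap (Z : Finset α) : ⋃ j ∈ Finset.range (Z.card + 1), gap Z j = (Z : Set α)ᶜ := by
  ext x
  simp only [mem_iUnion, gap, mem_ofPred_eq, mem_compl_iff, Finset.mem_coe,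
    Finset.mem_range_succ_iff]
  exact ⟨fun ⟨_, _, hx⟩ => hx.1, fun hx => ⟨_, Finset.card_filter_le _ _, hx, rfl⟩⟩

lemma pairwise_disjoint_gap (Z : Finset α) : Pairwise (Function.onFun Disjoint (gap Z)) :=
  fun _ _ hij => disjoint_left.2 fun _ hi hj => hij (hi.2.symm.trans hj.2)

lemma card_eq_sum_gap_add_sum {R Z : Finset α} (hR : ∀ j, (↑R ∩ gap Z j).Subsingleton) :
    R.card = (∑ j ∈ Finset.range (Z.card + 1), if (↑R ∩ gap Z j).Nonempty then 1 else 0) +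
      ∑ z ∈ Z, if z ∈ R then 1 else 0 := by
  have hfiber : ∀ j, ((R.filter (· ∉ Z)).filter fun x => (Z.filter (· < x)).card = j).card =
      if (↑R ∩ gap Z j).Nonempty then 1 else 0 := by
    intro j
    have hset : (((R.filter (· ∉ Z)).filter fun x => (Z.filter (· < x)).card = j : Finset α) :
        Set α) = ↑R ∩ gap Z j := by
      ext x
      simp [gap, and_assoc]
    rw [← ncard_coe_finset, hset]
    split_ifs with hne
    · obtain ⟨x, hx⟩ := hne
      rw [(hR j).eq_singleton_of_mem hx, ncard_singleton]
    · rw [not_nonempty_iff_eq_empty.1 hne, ncard_empty]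
  have hmaps : MapsTo (fun x => (Z.filter (· < x)).card) ((R.filter (· ∉ Z) : Finset α) : Set α)
      (Finset.range (Z.card + 1) : Finset ℕ) := fun x _ =>
    Finset.mem_coe.2 (Finset.mem_range_succ_iff.2 (Finset.card_filter_le _ _))
  have hZ : R.filter (· ∈ Z) = Z.filter (· ∈ R) := by
    ext x
    simp [and_comm]
  rw [← Finset.card_filter_add_card_filter_not (s := R) (· ∈ Z), add_comm,
    Finset.card_eq_sum_card_fiberwise hmaps, hZ, Finset.card_filter (· ∈ R)]
  simp only [hfiber]

end gap

lemma injOn_of_hasDerivAt_ne_zero {s : Set ℝ} (hs : s.OrdConnected) {f f' : ℝ → ℝ}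
    (hf : ∀ x ∈ s, HasDerivAt f (f' x) x) (hf' : ∀ x ∈ s, f' x ≠ 0) : InjOn f s := by
  have hlt : ∀ x ∈ s, ∀ y ∈ s, x < y → f x ≠ f y := by
    intro x hx y hy hxy heq
    have hsub := hs.out hx hy
    obtain ⟨c, hc, hc0⟩ := exists_hasDerivAt_eq_zero hxy
      (fun c hc => (hf c (hsub hc)).continuousAt.continuousWithinAt) heq
      (fun c hc => hf c (hsub (Ioo_subset_Icc_self hc)))
    exact hf' c (hsub (Ioo_subset_Icc_self hc)) hc0
  intro x hx y hy heq
  rcases lt_trichotomy x y with hxy | hxy | hxy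
  · exact absurd heq (hlt x hx y hy hxy)
  · exact hxy
  · exact absurd heq.symm (hlt y hy x hx hxy)

/-! ### The root count along a line of polynomials `h + t X ^ k` -/

/-- The numerator of the derivative of the rational function `h / X ^ k`, written over the
denominator `X ^ (k + 1)`. -/
noncomputable def critPoly (h : ℝ[X]) (k : ℕ) : ℝ[X] := X * derivative h - C (k : ℝ) * h

lemma critPoly_coeff (h : ℝ[X]) (k j : ℕ) :
    (critPoly h k).coeff j = ((j : ℝ) - k) * h.coeff j := by
  rw [critPoly, coeff_sub, coeff_C_mul]
  cases j with
  | zero => simp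
  | succ j => rw [coeff_X_mul, coeff_derivative]; push_cast; ring

lemma eq_monomial_of_critPoly_eq_zero {h : ℝ[X]} {k : ℕ} (hcrit : critPoly h k = 0) :
    h = monomial k (h.coeff k) := by
  ext j
  have hj := critPoly_coeff h k j
  rw [hcrit, coeff_zero, eq_comm, mul_eq_zero, sub_eq_zero, Nat.cast_inj] at hj
  rw [coeff_monomial]
  split_ifs with hkj
  · rw [hkj]
  · exact hj.resolve_left (Ne.symm hkj)

/-- The points at which `h / X ^ k` is singular or critical. -/
noncomputable def critSet (h : ℝ[X]) (k : ℕ) : Finset ℝ := insert 0 (critPoly h k).roots.toFinset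

lemma critSet_card_le (h : ℝ[X]) (k : ℕ) : (critSet h k).card ≤ h.natDegree + 1 := by
  have hdeg : (critPoly h k).natDegree ≤ h.natDegree :=
    natDegree_le_iff_coeff_eq_zero.2 fun j hj => by
      rw [critPoly_coeff, coeff_eq_zero_of_natDegree_lt hj, mul_zero]
  exact (Finset.card_insert_le _ _).trans (Nat.succ_le_succ
    ((Multiset.toFinset_card_le _).trans ((card_roots' _).trans hdeg)))

lemma zero_notMem_gap_critSet (h : ℝ[X]) (k j : ℕ) : (0 : ℝ) ∉ gap (critSet h k) j :=
  fun h0 => h0.1 (Finset.mem_insert_self _ _)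

lemma eval_critPoly_ne_zero_of_mem_gap {h : ℝ[X]} {k j : ℕ} (hcrit : critPoly h k ≠ 0) {x : ℝ}
    (hx : x ∈ gap (critSet h k) j) : (critPoly h k).eval x ≠ 0 := fun h0 =>
  hx.1 (Finset.mem_insert_of_mem (Multiset.mem_toFinset.2 ((mem_roots hcrit).2 h0)))

lemma hasDerivAt_eval_div_pow (h : ℝ[X]) (k : ℕ) {x : ℝ} (hx : x ≠ 0) :
    HasDerivAt (fun x => h.eval x / x ^ k) ((critPoly h k).eval x / x ^ (k + 1)) x := by
  refine ((h.hasDerivAt x).fun_div (hasDerivAt_pow k x) (pow_ne_zero k hx)).congr_deriv ?_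
  simp only [critPoly, eval_sub, eval_mul, eval_X, eval_C]
  cases k with
  | zero => field_simp; simp
  | succ k => rw [Nat.add_sub_cancel]; field_simp; ring

lemma injOn_eval_div_pow_gap {h : ℝ[X]} {k : ℕ} (hcrit : critPoly h k ≠ 0) (j : ℕ) :
    InjOn (fun x => h.eval x / x ^ k) (gap (critSet h k) j) := by
  have hne : ∀ x ∈ gap (critSet h k) j, x ≠ 0 := fun x hx =>
    ne_of_mem_of_not_mem hx (zero_notMem_gap_critSet h k j)
  exact injOn_of_hasDerivAt_ne_zero (gap_ordConnected _ _)
    (fun x hx => hasDerivAt_eval_div_pow h k (hne x hx))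
    (fun x hx => div_ne_zero (eval_critPoly_ne_zero_of_mem_gap hcrit hx) (pow_ne_zero _ (hne x hx)))

/-- The parameters `t` for which the polynomial `h + t X ^ k` has a root in `S`. -/
def rootParams (h : ℝ[X]) (k : ℕ) (S : Set ℝ) : Set ℝ :=
  {t | ∃ x ∈ S, (h + monomial k t).eval x = 0}

lemma eval_add_monomial_eq_zero_iff (h : ℝ[X]) (k : ℕ) (t : ℝ) {x : ℝ} (hx : x ≠ 0) :
    (h + monomial k t).eval x = 0 ↔ -(h.eval x / x ^ k) = t := by
  rw [eval_add, eval_monomial, neg_eq_iff_eq_neg, div_eq_iff (pow_ne_zero _ hx),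
    add_eq_zero_iff_eq_neg, neg_mul]

lemma rootParams_eq_image (h : ℝ[X]) (k : ℕ) {S : Set ℝ} (hS : 0 ∉ S) :
    rootParams h k S = (fun x => -(h.eval x / x ^ k)) '' S := by
  ext t
  exact exists_congr fun x => and_congr_right fun hx =>
    eval_add_monomial_eq_zero_iff h k t (ne_of_mem_of_not_mem hx hS)

lemma ordConnected_rootParams (h : ℝ[X]) (k : ℕ) {S : Set ℝ} (hS : S.OrdConnected)
    (hS0 : 0 ∉ S) : (rootParams h k S).OrdConnected := by
  rw [rootParams_eq_image h k hS0]
  refine ((isPreconnected_iff_ordConnected.2 hS).image _ fun x hx => ?_).ordConnected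
  exact (hasDerivAt_eval_div_pow h k (ne_of_mem_of_not_mem hx hS0)).continuousAt.neg
    |>.continuousWithinAt

lemma ordConnected_rootParams_of_subsingleton (h : ℝ[X]) (k : ℕ) {S : Set ℝ}
    (hS : S.Subsingleton) : (rootParams h k S).OrdConnected := by
  refine ⟨?_⟩
  rintro s ⟨x, hx, hs⟩ t ⟨y, hy, ht⟩ v hv
  obtain rfl := hS hx hy
  refine ⟨x, hx, ?_⟩
  simp only [eval_add, eval_monomial] at hs ht ⊢
  have hst : (t - s) * x ^ k = 0 := by linear_combination ht - hs
  rcases mul_eq_zero.1 hst with hts | hxk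
  · have hvs : v = s := le_antisymm (by linarith [hv.2]) hv.1
    rw [hvs, hs]
  · simpa [hxk] using hs

lemma rootCount_add_monomial_eq_sum (R : Type*) [NonAssocSemiring R] (I : Set ℝ) {h : ℝ[X]} {k : ℕ}
    (hcrit : critPoly h k ≠ 0) (t : ℝ) :
    (rootCount I (h + monomial k t) : R) =
      (∑ j ∈ Finset.range ((critSet h k).card + 1),
        (rootParams h k (I ∩ gap (critSet h k) j)).indicator 1 t) +
      ∑ z ∈ critSet h k, (rootParams h k (I ∩ {z})).indicator 1 t := by
  have hne : h + monomial k t ≠ 0 := by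
    intro h0
    refine hcrit (Polynomial.ext fun j => ?_)
    rw [critPoly_coeff, eq_neg_of_add_eq_zero_left h0, coeff_neg, coeff_monomial]
    split_ifs with hkj <;> simp [hkj]
  rw [rootCount, card_eq_sum_gap_add_sum (Z := critSet h k)]
  · simp only [Nat.cast_add, Nat.cast_sum, Nat.cast_ite, Nat.cast_one, Nat.cast_zero]
    congr 1 <;> refine Finset.sum_congr rfl fun j _ => if_congr ?_ rfl rfl
    · refine exists_congr fun x => ?_
      rw [mem_inter_iff, mem_inter_iff, Finset.mem_coe, mem_filter_roots hne]
      tauto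
    · simp only [mem_filter_roots hne, rootParams, mem_inter_iff, mem_singleton_iff,
        mem_ofPred_eq]
      exact ⟨fun hj => ⟨j, ⟨hj.1, rfl⟩, hj.2⟩, by rintro ⟨x, ⟨hx, rfl⟩, h0⟩; exact ⟨hx, h0⟩⟩
  · rintro j x ⟨hx, hxj⟩ y ⟨hy, hyj⟩
    have hparam : ∀ x ∈ gap (critSet h k) j, x ∈ (h + monomial k t).roots.toFinset.filter (· ∈ I) →
        -(h.eval x / x ^ k) = t := fun x hxj hx =>
      (eval_add_monomial_eq_zero_iff h k t (ne_of_mem_of_not_mem hxj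
        (zero_notMem_gap_critSet h k j))).1 ((mem_filter_roots hne).1 hx).2
    exact injOn_eval_div_pow_gap hcrit j hxj hyj
      (neg_injective ((hparam x hxj hx).trans (hparam y hyj hy).symm))

lemma rootCount_monomial (I : Set ℝ) (k : ℕ) (t : ℝ) :
    rootCount I (monomial k t) = if t ≠ 0 ∧ k ≠ 0 ∧ 0 ∈ I then 1 else 0 := by
  rcases eq_or_ne t 0 with rfl | ht
  · simp [rootCount_zero]
  rcases eq_or_ne k 0 with rfl | hk
  · simp [rootCount]
  rw [rootCount, roots_monomial ht, Multiset.toFinset_nsmul _ _ hk, Multiset.toFinset_singleton,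
    Finset.filter_singleton]
  split_ifs <;> simp_all

lemma abs_latticeDiscrepancy_rootCount_monomial_le (I : Set ℝ) (k : ℕ) (c Q : ℝ) :
    |latticeDiscrepancy Q (fun t => (rootCount I (monomial k c + monomial k t) : ℝ))| ≤ 2 := by
  have hcount : ∀ t : ℝ, (rootCount I (monomial k c + monomial k t) : ℝ) =
      if k ≠ 0 ∧ 0 ∈ I then (Iio (-c)).indicator 1 t + (Ioi (-c)).indicator 1 t else 0 := by
    intro t
    rw [← map_add, rootCount_monomial]
    by_cases hkI : k ≠ 0 ∧ 0 ∈ I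
    · rcases lt_trichotomy t (-c) with ht | rfl | ht
      · simp [hkI, ht, ht.not_gt, show c + t ≠ 0 by linarith]
      · simp
      · simp [hkI, ht, ht.not_gt, show c + t ≠ 0 by linarith]
    · rw [if_neg hkI, if_neg fun h => hkI h.2, Nat.cast_zero]
  simp only [hcount]
  split_ifs with hkI
  · rw [latticeDiscrepancy_add Q (integrableOn_indicator_one ordConnected_Iio Q)
      (integrableOn_indicator_one ordConnected_Ioi Q)]
    linarith [abs_add_le (latticeDiscrepancy Q ((Iio (-c)).indicator 1))
        (latticeDiscrepancy Q ((Ioi (-c)).indicator 1)),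
      abs_latticeDiscrepancy_indicator_le (ordConnected_Iio (a := -c)) Q,
      abs_latticeDiscrepancy_indicator_le (ordConnected_Ioi (a := -c)) Q]
  · simp [latticeDiscrepancy]

/- Between consecutive critical points of `h / X ^ k` there is at most one root, and the `t` for
which it exists form an interval; a sum of boundedly many indicators of intervals has bounded
discrepancy. -/
lemma abs_latticeDiscrepancy_rootCount_add_monomial_le {I : Set ℝ} (hI : I.OrdConnected)
    (h : ℝ[X]) (k : ℕ) (Q : ℝ) :
    |latticeDiscrepancy Q (fun t => (rootCount I (h + monomial k t) : ℝ))| ≤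
      2 * h.natDegree + 3 := by
  by_cases hcrit : critPoly h k = 0
  · rw [eq_monomial_of_critPoly_eq_zero hcrit]
    linarith [abs_latticeDiscrepancy_rootCount_monomial_le I k (h.coeff k) Q,
      Nat.cast_nonneg (α := ℝ) (monomial k (h.coeff k)).natDegree]
  have hgap : ∀ j ∈ Finset.range ((critSet h k).card + 1),
      (rootParams h k (I ∩ gap (critSet h k) j)).OrdConnected := fun j _ =>
    ordConnected_rootParams h k (hI.inter (gap_ordConnected _ _))
      fun h0 => zero_notMem_gap_critSet h k j h0.2
  have hpoint : ∀ z ∈ critSet h k, (rootParams h k (I ∩ {z})).OrdConnected := fun z _ =>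
    ordConnected_rootParams_of_subsingleton h k (subsingleton_singleton.anti inter_subset_right)
  simp only [rootCount_add_monomial_eq_sum ℝ I hcrit]
  rw [latticeDiscrepancy_add Q
    (integrable_finsetSum _ fun j hj => integrableOn_indicator_one (hgap j hj) Q)
    (integrable_finsetSum _ fun z hz => integrableOn_indicator_one (hpoint z hz) Q)]
  have hZ : ((critSet h k).card : ℝ) ≤ h.natDegree + 1 := by exact_mod_cast critSet_card_le h k
  have hgap_le := abs_latticeDiscrepancy_sum_indicator_le _ hgap Q
  have hpoint_le := abs_latticeDiscrepancy_sum_indicator_le _ hpoint Q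
  rw [Finset.card_range, Nat.cast_add_one] at hgap_le
  refine (abs_add_le _ _).trans ?_
  linarith

lemma abs_latticeDiscrepancy_rootCount_ofFn_le {I : Set ℝ} (hI : I.OrdConnected) {m : ℕ}
    (a : Fin m → ℝ) (k : Fin m) (Q : ℝ) :
    |latticeDiscrepancy Q (fun t => (rootCount I (ofFn m (Function.update a k t)) : ℝ))| ≤
      2 * m + 1 := by
  rw [funext fun t => congrArg (fun p => (rootCount I p : ℝ)) (ofFn_update a k t)]
  have hdeg : (((ofFn m (Function.update a k 0)).natDegree + 1 : ℕ) : ℝ) ≤ m :=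
    Nat.cast_le.2 (ofFn_natDegree_lt k.pos _)
  push_cast at hdeg
  linarith [abs_latticeDiscrepancy_rootCount_add_monomial_le hI
    (ofFn m (Function.update a k 0)) k Q]

/-! ### Measurability of the root count -/

lemma isLocallyClosed_of_ordConnected {S : Set ℝ} (hS : S.OrdConnected) : IsLocallyClosed S := by
  have hint := (isPreconnected_iff_ordConnected.2 hS).mem_intervals
  simp only [mem_insert_iff, mem_singleton_iff] at hint
  rcases hint with h | h | h | h | h | h | h | h | h | h <;> rw [h]
  · exact isClosed_Icc.isLocallyClosed
  · exact isLocallyClosed_Ico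
  · exact isLocallyClosed_Ioc
  · exact isOpen_Ioo.isLocallyClosed
  · exact isClosed_Ici.isLocallyClosed
  · exact isOpen_Ioi.isLocallyClosed
  · exact isClosed_Iic.isLocallyClosed
  · exact isOpen_Iio.isLocallyClosed
  · exact isOpen_univ.isLocallyClosed
  · exact isOpen_empty.isLocallyClosed

lemma continuous_eval_ofFn (m : ℕ) :
    Continuous fun q : (Fin m → ℝ) × ℝ => (ofFn m q.1).eval q.2 := by
  simp only [ofFn_eval]
  fun_prop

/- The set is the projection of a locally closed, hence σ-compact, subset of `ℝ ^ m × ℝ`. -/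
lemma measurableSet_exists_root {S : Set ℝ} (hS : S.OrdConnected) (m : ℕ) :
    MeasurableSet {a : Fin m → ℝ | ∃ x ∈ S, (ofFn m a).eval x = 0} := by
  set L : Set ((Fin m → ℝ) × ℝ) := {q | q.2 ∈ S ∧ (ofFn m q.1).eval q.2 = 0}
  have hLc : IsLocallyClosed L :=
    ((isLocallyClosed_of_ordConnected hS).preimage continuous_snd).inter
      (isClosed_eq (continuous_eval_ofFn m) continuous_const).isLocallyClosed
  have : LocallyCompactSpace L := hLc.locallyCompactSpace
  have hσ : IsSigmaCompact L := isSigmaCompact_iff_sigmaCompactSpace.2 inferInstance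
  have himage : {a : Fin m → ℝ | ∃ x ∈ S, (ofFn m a).eval x = 0} = Prod.fst '' L := by
    ext a
    simp [L]
  obtain ⟨K, hK, hKL⟩ := hσ.image continuous_fst
  rw [himage, ← hKL]
  exact MeasurableSet.iUnion fun i => (hK i).measurableSet

lemma eventually_floor_mul_ne {x y : ℝ} (hxy : x < y) :
    ∀ᶠ M : ℕ in atTop, ⌊(M : ℝ) * x⌋ ≠ ⌊(M : ℝ) * y⌋ := by
  have htend : Tendsto (fun M : ℕ => (M : ℝ) * (y - x)) atTop atTop :=
    tendsto_natCast_atTop_atTop.atTop_mul_const (sub_pos.2 hxy)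
  filter_upwards [htend.eventually_ge_atTop 1] with M hM heq
  have hdist := Int.abs_sub_lt_one_of_floor_eq_floor heq.symm
  rw [← mul_sub] at hdist
  exact absurd ((le_abs_self _).trans_lt hdist) hM.not_gt

lemma exists_injOn_floor_mul (R : Finset ℝ) :
    ∃ M : ℕ, InjOn (fun x : ℝ => ⌊(M : ℝ) * x⌋) R := by
  have hev : ∀ᶠ M : ℕ in atTop, ∀ x ∈ R, ∀ y ∈ R, x ≠ y → ⌊(M : ℝ) * x⌋ ≠ ⌊(M : ℝ) * y⌋ := by
    simp only [Filter.eventually_all_finset, Filter.eventually_imp_distrib_left]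
    intro x _ y _ hxy
    rcases hxy.lt_or_gt with hlt | hgt
    · exact eventually_floor_mul_ne hlt
    · exact (eventually_floor_mul_ne hgt).mono fun _ => Ne.symm
  obtain ⟨M, hM⟩ := hev.exists
  exact ⟨M, fun x hx y hy => not_imp_not.1 (hM x hx y hy)⟩

lemma le_rootCount_iff (I : Set ℝ) {q : ℝ[X]} (hq : q ≠ 0) (j : ℕ) :
    j ≤ rootCount I q ↔ ∃ (M : ℕ) (K : Finset ℤ), K.card = j ∧
      ∀ k ∈ K, ∃ x ∈ I ∩ {x | ⌊(M : ℝ) * x⌋ = k}, q.eval x = 0 := by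
  constructor
  · intro hj
    obtain ⟨M, hM⟩ := exists_injOn_floor_mul (q.roots.toFinset.filter (· ∈ I))
    rw [rootCount, ← Finset.card_image_of_injOn hM] at hj
    obtain ⟨K, hK, hKj⟩ := Finset.exists_subset_card_eq hj
    refine ⟨M, K, hKj, fun k hk => ?_⟩
    obtain ⟨x, hx, hxk⟩ := Finset.mem_image.1 (hK hk)
    rw [mem_filter_roots hq] at hx
    exact ⟨x, ⟨hx.1, hxk⟩, hx.2⟩
  · rintro ⟨M, K, rfl, hK⟩
    have hsub : K ⊆ (q.roots.toFinset.filter (· ∈ I)).image (fun x : ℝ => ⌊(M : ℝ) * x⌋) := by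
      intro k hk
      obtain ⟨x, ⟨hxI, hxk⟩, hx0⟩ := hK k hk
      exact Finset.mem_image.2 ⟨x, (mem_filter_roots hq).2 ⟨hxI, hx0⟩, hxk⟩
    exact (Finset.card_le_card hsub).trans Finset.card_image_le

lemma ordConnected_floor_mul_eq (M : ℕ) (k : ℤ) : {x : ℝ | ⌊(M : ℝ) * x⌋ = k}.OrdConnected :=
  ordConnected_singleton.preimage_mono
    (Int.floor_mono.comp (monotone_mul_left_of_nonneg M.cast_nonneg))

lemma measurable_rootCount {I : Set ℝ} (hI : I.OrdConnected) (m : ℕ) :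
    Measurable fun a : Fin m → ℝ => rootCount I (ofFn m a) := by
  refine measurable_of_Ici fun j => ?_
  rcases Nat.eq_zero_or_pos j with rfl | hj
  · simp
  have hpre : (fun a : Fin m → ℝ => rootCount I (ofFn m a)) ⁻¹' Ici j =
      {0}ᶜ ∩ ⋃ (M : ℕ), ⋃ (K : Finset ℤ), ⋃ (_ : K.card = j), ⋂ k ∈ K,
        {a : Fin m → ℝ | ∃ x ∈ I ∩ {x | ⌊(M : ℝ) * x⌋ = k}, (ofFn m a).eval x = 0} := by
    ext a
    rcases eq_or_ne a 0 with rfl | ha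
    · simp [rootCount_zero, hj.ne']
    · rw [mem_preimage, mem_Ici, le_rootCount_iff I (ofFn_eq_zero_iff.not.2 ha) j]
      simp [ha]
  rw [hpre]
  exact (MeasurableSet.singleton _).compl.inter <|
    MeasurableSet.iUnion fun M => MeasurableSet.iUnion fun K => MeasurableSet.iUnion fun _ =>
      Finset.measurableSet_biInter _ fun k _ =>
        measurableSet_exists_root (hI.inter (ordConnected_floor_mul_eq M k)) m

lemma measurable_rootCount_real {I : Set ℝ} (hI : I.OrdConnected) (m : ℕ) :
    Measurable fun a : Fin m → ℝ => (rootCount I (ofFn m a) : ℝ) :=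
  measurable_from_top.comp (measurable_rootCount hI m)

/-! ### Lattice points in cubes -/

/-- The cube `[-Q, Q] ^ m`. -/
def box (m : ℕ) (Q : ℝ) : Set (Fin m → ℝ) := univ.pi fun _ => Icc (-Q) Q

/-- The integer points of the cube `[-Q, Q] ^ m`. -/
noncomputable def intBox (m : ℕ) (Q : ℝ) : Finset (Fin m → ℤ) := Fintype.piFinset fun _ => intIcc Q

lemma mem_intBox {m : ℕ} {Q : ℝ} {a : Fin m → ℤ} : a ∈ intBox m Q ↔ ∀ i, |(a i : ℝ)| ≤ Q := by
  simp only [intBox, Fintype.mem_piFinset, mem_intIcc]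

lemma card_intBox_le (m : ℕ) {Q : ℝ} (hQ : 1 ≤ Q) : ((intBox m Q).card : ℝ) ≤ (3 * Q) ^ m := by
  rw [intBox, Fintype.card_piFinset_const, Nat.cast_pow]
  gcongr
  exact card_intIcc_le hQ

lemma isCompact_box (m : ℕ) (Q : ℝ) : IsCompact (box m Q) :=
  isCompact_univ_pi fun _ => isCompact_Icc

lemma volume_real_box (m : ℕ) {Q : ℝ} (hQ : 0 ≤ Q) : volume.real (box m Q) = (2 * Q) ^ m := by
  rw [measureReal_def, box, volume_pi_pi, Finset.prod_const, Finset.card_univ, Fintype.card_fin,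
    Real.volume_Icc, ENNReal.toReal_pow, ENNReal.toReal_ofReal (by linarith)]
  ring

lemma smul_box (m : ℕ) {Q : ℝ} (hQ : 0 < Q) (R : ℝ) : Q • box m R = box m (Q * R) := by
  ext a
  rw [mem_smul_set_iff_inv_smul_mem₀ hQ.ne']
  simp only [box, mem_univ_pi, Pi.smul_apply, smul_eq_mul, mem_Icc, ← div_eq_inv_mul,
    le_div_iff₀ hQ, div_le_iff₀ hQ, neg_mul, mul_comm R]

instance isFiniteMeasure_restrict_box (m : ℕ) (Q : ℝ) :
    IsFiniteMeasure (volume.restrict (box m Q)) :=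
  ⟨by rw [Measure.restrict_apply_univ]; exact (isCompact_box m Q).measure_lt_top⟩

lemma integrableOn_box {m : ℕ} {f : (Fin m → ℝ) → ℝ} (hf : Measurable f) {B : ℝ}
    (hB : ∀ a, |f a| ≤ B) (Q : ℝ) : IntegrableOn f (box m Q) :=
  Integrable.of_bound hf.aestronglyMeasurable B (Eventually.of_forall hB)

lemma piFinSuccAbove_symm_eq_cons (m : ℕ) :
    ((MeasurableEquiv.piFinSuccAbove (fun _ : Fin (m + 1) => ℝ) 0).symm :
      ℝ × (Fin m → ℝ) → Fin (m + 1) → ℝ) = fun p => Fin.cons p.1 p.2 := by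
  funext p
  rw [MeasurableEquiv.piFinSuccAbove_symm_apply]
  simp [Fin.insertNthEquiv, Fin.insertNth_zero']

lemma measurePreserving_cons_box (m : ℕ) (Q : ℝ) :
    MeasurePreserving (fun p : ℝ × (Fin m → ℝ) => (Fin.cons p.1 p.2 : Fin (m + 1) → ℝ))
      ((volume.restrict (Icc (-Q) Q)).prod (volume.restrict (box m Q)))
      (volume.restrict (box (m + 1) Q)) := by
  have hpi : ∀ k : ℕ, Measure.pi (fun _ : Fin k => (volume : Measure ℝ).restrict (Icc (-Q) Q)) =
      volume.restrict (box k Q) := fun k => by rw [box, volume_pi, Measure.restrict_pi_pi]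
  have hpres := (measurePreserving_piFinSuccAbove
    (fun _ : Fin (m + 1) => (volume : Measure ℝ).restrict (Icc (-Q) Q)) 0).symm
  rwa [hpi, hpi, piFinSuccAbove_symm_eq_cons] at hpres

lemma measurable_cons (m : ℕ) :
    Measurable fun p : ℝ × (Fin m → ℝ) => (Fin.cons p.1 p.2 : Fin (m + 1) → ℝ) :=
  (measurePreserving_cons_box m 0).measurable

lemma measurable_comp_cons {m : ℕ} {f : (Fin (m + 1) → ℝ) → ℝ} (hf : Measurable f) (t : ℝ) :
    Measurable fun b : Fin m → ℝ => f (Fin.cons t b : Fin (m + 1) → ℝ) :=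
  hf.comp ((measurable_cons m).comp measurable_prodMk_left)

lemma integrable_comp_cons_box {m : ℕ} {f : (Fin (m + 1) → ℝ) → ℝ} (hf : Measurable f) {B : ℝ}
    (hB : ∀ a, |f a| ≤ B) (Q : ℝ) :
    Integrable (fun p : ℝ × (Fin m → ℝ) => f (Fin.cons p.1 p.2 : Fin (m + 1) → ℝ))
      ((volume.restrict (Icc (-Q) Q)).prod (volume.restrict (box m Q))) :=
  Integrable.of_bound (hf.comp (measurable_cons m)).aestronglyMeasurable B
    (Eventually.of_forall fun _ => hB _)

lemma integral_box_succ {m : ℕ} {f : (Fin (m + 1) → ℝ) → ℝ} (hf : Measurable f) {B : ℝ}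
    (hB : ∀ a, |f a| ≤ B) (Q : ℝ) :
    ∫ a in box (m + 1) Q, f a =
      ∫ b in box m Q, ∫ t in Icc (-Q) Q, f (Fin.cons t b : Fin (m + 1) → ℝ) := by
  rw [← (measurePreserving_cons_box m Q).map_eq, integral_map (measurable_cons m).aemeasurable
    hf.aestronglyMeasurable, integral_prod_symm _ (integrable_comp_cons_box hf hB Q)]

lemma lintegral_box_succ {m : ℕ} {f : (Fin (m + 1) → ℝ) → ENNReal} (hf : Measurable f) (Q : ℝ) :
    ∫⁻ a in box (m + 1) Q, f a =
      ∫⁻ b in box m Q, ∫⁻ t in Icc (-Q) Q, f (Fin.cons t b : Fin (m + 1) → ℝ) := by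
  rw [← (measurePreserving_cons_box m Q).lintegral_comp hf]
  exact lintegral_prod_symm _ (hf.comp (measurable_cons m)).aemeasurable

lemma sum_intBox_succ {m : ℕ} (f : (Fin (m + 1) → ℤ) → ℝ) (Q : ℝ) :
    ∑ a ∈ intBox (m + 1) Q, f a =
      ∑ t ∈ intIcc Q, ∑ b ∈ intBox m Q, f (Fin.cons t b : Fin (m + 1) → ℤ) := by
  rw [← Finset.sum_product']
  refine Finset.sum_equiv (Fin.consEquiv fun _ => ℤ).symm (fun a => ?_) (fun a _ => ?_)
  · simp [intBox, Fin.consEquiv, Fin.forall_fin_succ, Fin.tail]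
  · simp [Fin.consEquiv]

lemma abs_sum_integral_box_sub_integral_le {m : ℕ} {f : (Fin (m + 1) → ℝ) → ℝ}
    (hf : Measurable f) {M : ℝ} (hM : ∀ a, |f a| ≤ M) {Q : ℝ} (hQ : 0 ≤ Q) {B : ℝ}
    (hB : ∀ b : Fin m → ℝ,
      |latticeDiscrepancy Q fun t => f (Fin.cons t b : Fin (m + 1) → ℝ)| ≤ B) :
    |(∑ t ∈ intIcc Q, ∫ b in box m Q, f (Fin.cons (t : ℝ) b : Fin (m + 1) → ℝ)) -
      ∫ a in box (m + 1) Q, f a| ≤ B * (2 * Q) ^ m := by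
  have hint : ∀ t : ℝ, IntegrableOn (fun b => f (Fin.cons t b : Fin (m + 1) → ℝ)) (box m Q) :=
    fun t => integrableOn_box (measurable_comp_cons hf t) (fun _ => hM _) Q
  rw [integral_box_succ hf hM, ← integral_finsetSum _ fun (t : ℤ) _ => hint t,
    ← integral_sub (integrable_finsetSum _ fun (t : ℤ) _ => hint t)
      (integrable_comp_cons_box hf hM Q).integral_prod_right,
    ← volume_real_box m hQ]
  exact norm_setIntegral_le_of_norm_le_const
    (f := fun b => latticeDiscrepancy Q fun t => f (Fin.cons t b : Fin (m + 1) → ℝ))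
    (isCompact_box m Q).measure_lt_top fun b _ => hB b

lemma sum_intBox_zero (f : (Fin 0 → ℝ) → ℝ) (Q : ℝ) :
    ∑ a ∈ intBox 0 Q, f (fun i => (a i : ℝ)) = ∫ a in box 0 Q, f a := by
  have hbox : box 0 Q = univ := eq_univ_of_forall fun a i => i.elim0
  rw [hbox, setIntegral_univ, volume_pi, Measure.pi_of_empty _ 0, integral_dirac]
  have hconst : ∀ a : Fin 0 → ℤ, f (fun i => (a i : ℝ)) = f 0 := fun a =>
    congrArg f (Subsingleton.elim _ _)
  simp only [hconst, intBox, Fintype.piFinset_of_isEmpty, Finset.sum_const, Finset.card_univ,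
    Fintype.card_unique, one_smul]

lemma intCast_cons {m : ℕ} (t : ℤ) (b : Fin m → ℤ) :
    (fun i => ((Fin.cons t b : Fin (m + 1) → ℤ) i : ℝ)) =
      (Fin.cons (t : ℝ) (fun i => (b i : ℝ)) : Fin (m + 1) → ℝ) :=
  funext fun i => Fin.cases rfl (fun _ => rfl) i

lemma abs_sum_intBox_sub_integral_le {Q : ℝ} (hQ : 1 ≤ Q) {B M : ℝ} {m : ℕ}
    {f : (Fin m → ℝ) → ℝ} (hf : Measurable f) (hM : ∀ a, |f a| ≤ M)
    (hB : ∀ a k, |latticeDiscrepancy Q fun t => f (Function.update a k t)| ≤ B) :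
    |∑ a ∈ intBox m Q, f (fun i => (a i : ℝ)) - ∫ a in box m Q, f a| ≤
      m * B * (3 * Q) ^ (m - 1) := by
  induction m with
  | zero => simp [sum_intBox_zero]
  | succ m ih =>
    have hB0 : 0 ≤ B := (abs_nonneg _).trans (hB 0 0)
    have hQ0 : 0 ≤ Q := by linarith
    have hslice : ∀ t : ℤ, |∑ b ∈ intBox m Q, f (Fin.cons (t : ℝ) fun i => (b i : ℝ)) -
        ∫ b in box m Q, f (Fin.cons (t : ℝ) b)| ≤ m * B * (3 * Q) ^ (m - 1) := fun t =>
      ih (measurable_comp_cons hf t) (fun _ => hM _) fun b k => by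
        simpa only [Fin.cons_update] using hB (Fin.cons (t : ℝ) b) k.succ
    have hslices : |∑ a ∈ intBox (m + 1) Q, f (fun i => (a i : ℝ)) -
        ∑ t ∈ intIcc Q, ∫ b in box m Q, f (Fin.cons (t : ℝ) b)| ≤ m * B * (3 * Q) ^ m := by
      simp only [sum_intBox_succ, intCast_cons]
      rw [← Finset.sum_sub_distrib]
      calc _ ≤ ∑ t ∈ intIcc Q, (m * B * (3 * Q) ^ (m - 1)) :=
            (Finset.abs_sum_le_sum_abs _ _).trans (Finset.sum_le_sum fun t _ => hslice t)
        _ ≤ (3 * Q) * (m * B * (3 * Q) ^ (m - 1)) := by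
            rw [Finset.sum_const, nsmul_eq_mul]
            gcongr
            exact card_intIcc_le hQ
        _ = m * B * (3 * Q) ^ m := by
            rcases m with - | m
            · simp
            · rw [Nat.add_sub_cancel]; ring
    have hfirst := abs_sum_integral_box_sub_integral_le hf hM hQ0 (B := B) fun b => by
      simpa only [Fin.update_cons_zero] using hB (Fin.cons 0 b) 0
    have hpow : B * (2 * Q) ^ m ≤ B * (3 * Q) ^ m := by gcongr; norm_num
    calc _ ≤ m * B * (3 * Q) ^ m + B * (3 * Q) ^ m :=
          (abs_sub_le _ _ _).trans (add_le_add hslices (hfirst.trans hpow))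
      _ = (m + 1 : ℕ) * B * (3 * Q) ^ (m + 1 - 1) := by
          rw [Nat.add_sub_cancel]; push_cast; ring

/-! ### Roots of integer polynomials of bounded height -/

/-- The total number of roots in `I` of the real polynomials with coefficient vector in the cube
`[-1, 1] ^ m`. -/
noncomputable def rootVolume (m : ℕ) (I : Set ℝ) : ℝ :=
  ∫ a in box m 1, (rootCount I (ofFn m a) : ℝ)

/-- The total number of roots in `I` of the integer polynomials of degree less than `m` and height
at most `Q`. -/
noncomputable def latticeCount (m : ℕ) (I : Set ℝ) (Q : ℝ) : ℝ :=
  ∑ a ∈ intBox m Q, (rootCount I (ofFn m fun i => (a i : ℝ)) : ℝ)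

lemma abs_rootCount_ofFn_le (I : Set ℝ) {m : ℕ} (a : Fin m → ℝ) :
    |(rootCount I (ofFn m a) : ℝ)| ≤ m := by
  rw [Nat.abs_cast]
  exact_mod_cast rootCount_ofFn_le I a

lemma integral_rootCount_box (m : ℕ) (I : Set ℝ) {Q : ℝ} (hQ : 0 < Q) :
    ∫ a in box m Q, (rootCount I (ofFn m a) : ℝ) = Q ^ m * rootVolume m I := by
  have hscale := Measure.setIntegral_comp_smul_of_pos (volume : Measure (Fin m → ℝ))
    (fun a => (rootCount I (ofFn m a) : ℝ)) (box m 1) hQ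
  simp only [smul_box m hQ, mul_one, rootCount_ofFn_smul I hQ.ne', Module.finrank_fin_fun,
    smul_eq_mul] at hscale
  rw [rootVolume, hscale, mul_inv_cancel_left₀ (pow_ne_zero m hQ.ne')]

lemma rootVolume_nonneg (m : ℕ) (I : Set ℝ) : 0 ≤ rootVolume m I :=
  integral_nonneg fun _ => Nat.cast_nonneg _

lemma rootVolume_le (m : ℕ) (I : Set ℝ) : rootVolume m I ≤ m * 2 ^ m := by
  have hnorm : ‖rootVolume m I‖ ≤ m * volume.real (box m 1) :=
    norm_setIntegral_le_of_norm_le_const (isCompact_box m 1).measure_lt_top fun a _ =>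
      abs_rootCount_ofFn_le I a
  rw [volume_real_box m zero_le_one, mul_one] at hnorm
  exact (le_abs_self _).trans hnorm

lemma latticeCount_of_lt_one (m : ℕ) (I : Set ℝ) {Q : ℝ} (hQ : Q < 1) :
    latticeCount m I Q = 0 := by
  refine Finset.sum_eq_zero fun a ha => ?_
  have hzero : (fun i => (a i : ℝ)) = 0 := funext fun i => by
    have hi : |a i| < 1 := by exact_mod_cast (mem_intBox.1 ha i).trans_lt hQ
    simp [Int.abs_lt_one_iff.1 hi]
  rw [hzero, map_zero, rootCount_zero, Nat.cast_zero]

lemma abs_latticeCount_sub_le_of_one_le {I : Set ℝ} (hI : I.OrdConnected) (n : ℕ) {Q : ℝ}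
    (hQ : 1 ≤ Q) :
    |latticeCount (n + 1) I Q - Q ^ (n + 1) * rootVolume (n + 1) I| ≤
      (n + 1) * (2 * n + 3) * 3 ^ n * Q ^ n := by
  rw [← integral_rootCount_box _ _ (by linarith)]
  refine (abs_sum_intBox_sub_integral_le hQ (measurable_rootCount_real hI (n + 1))
    (abs_rootCount_ofFn_le I)
    (fun a k => abs_latticeDiscrepancy_rootCount_ofFn_le hI a k Q)).trans_eq ?_
  push_cast
  ring

lemma abs_latticeCount_sub_le_of_lt_one (I : Set ℝ) (n : ℕ) {Q : ℝ} (hQ0 : 0 < Q) (hQ : Q < 1) :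
    |latticeCount (n + 1) I Q - Q ^ (n + 1) * rootVolume (n + 1) I| ≤
      (n + 1) * 2 ^ (n + 1) * Q ^ n := by
  have hnonneg := rootVolume_nonneg (n + 1) I
  rw [latticeCount_of_lt_one _ _ hQ, zero_sub, abs_neg, abs_of_nonneg (by positivity), mul_comm]
  gcongr ?_ * ?_
  · exact_mod_cast rootVolume_le (n + 1) I
  · exact pow_le_pow_of_le_one hQ0.le hQ.le (Nat.le_succ n)

lemma exists_abs_latticeCount_sub_le (n : ℕ) : ∃ C : ℝ, 0 ≤ C ∧ ∀ I : Set ℝ, I.OrdConnected →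
    ∀ Q : ℝ, 0 < Q →
      |latticeCount (n + 1) I Q - Q ^ (n + 1) * rootVolume (n + 1) I| ≤ C * Q ^ n := by
  refine ⟨max ((n + 1) * (2 * n + 3) * 3 ^ n) ((n + 1) * 2 ^ (n + 1)),
    le_max_of_le_left (by positivity), fun I hI Q hQ => ?_⟩
  rw [max_mul_of_nonneg _ _ (by positivity)]
  rcases le_or_gt 1 Q with hQ1 | hQ1
  · exact le_max_of_le_left (abs_latticeCount_sub_le_of_one_le hI n hQ1)
  · exact le_max_of_le_right (abs_latticeCount_sub_le_of_lt_one I n hQ hQ1)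

/-! ### The density of roots -/

/-- The integrand of the area formula for `x ↦ -h(x)`, truncated to values in `[-1, 1]`. -/
noncomputable def densityKernel (h : ℝ[X]) (x : ℝ) : ℝ :=
  if |h.eval x| ≤ 1 then |(derivative h).eval x| else 0

lemma densityKernel_nonneg (h : ℝ[X]) (x : ℝ) : 0 ≤ densityKernel h x := by
  unfold densityKernel
  split_ifs
  exacts [abs_nonneg _, le_rfl]

lemma norm_densityKernel_le (h : ℝ[X]) (x : ℝ) :
    ‖densityKernel h x‖ ≤ ‖(derivative h).eval x‖ := by
  unfold densityKernel
  split_ifs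
  · exact (norm_abs_eq_norm _).le
  · rw [norm_zero]; exact norm_nonneg _

lemma volume_rootParams_inter_Icc {h : ℝ[X]} {S : Set ℝ} (hS : MeasurableSet S) (hS0 : 0 ∉ S)
    (hinj : InjOn (fun x => h.eval x) S) :
    volume (rootParams h 0 S ∩ Icc (-1) 1) = ∫⁻ x in S, ENNReal.ofReal (densityKernel h x) := by
  set T : Set ℝ := {x | |h.eval x| ≤ 1}
  have hT : MeasurableSet T := measurableSet_le h.continuous.abs.measurable measurable_const
  have himage : rootParams h 0 S ∩ Icc (-1) 1 = (fun x => -h.eval x) '' (T ∩ S) := by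
    have hpre : T = (fun x => -h.eval x) ⁻¹' Icc (-1) 1 := by
      ext x
      rw [mem_preimage, mem_Icc, ← abs_le, abs_neg]
      rfl
    rw [hpre, image_preimage_inter, inter_comm, rootParams_eq_image h 0 hS0]
    simp only [pow_zero, div_one]
  have harea := lintegral_image_eq_lintegral_abs_deriv_mul (f := fun x => -h.eval x) (hT.inter hS)
    (fun x _ => (h.hasDerivAt x).neg.hasDerivWithinAt)
    (fun x hx y hy hxy => hinj hx.2 hy.2 (neg_injective hxy)) 1
  simp only [Pi.one_apply, mul_one, abs_neg, setLIntegral_one] at harea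
  rw [himage, harea, ← setLIntegral_indicator hT]
  refine lintegral_congr fun x => ?_
  by_cases hx : |h.eval x| ≤ 1
  · rw [indicator_of_mem (show x ∈ T from hx), densityKernel, if_pos hx]
  · rw [indicator_of_notMem (show x ∉ T from hx), densityKernel, if_neg hx, ENNReal.ofReal_zero]

lemma lintegral_rootParams_singleton (h : ℝ[X]) (S A : Set ℝ) (z : ℝ) :
    ∫⁻ t in A, (rootParams h 0 (S ∩ {z})).indicator 1 t = (0 : ENNReal) := by
  have hsub : (rootParams h 0 (S ∩ {z})).Subsingleton := by
    rintro s ⟨x, ⟨-, rfl⟩, hs⟩ t ⟨y, ⟨-, rfl⟩, ht⟩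
    simp only [eval_add, eval_monomial, pow_zero, mul_one] at hs ht
    linarith
  rw [lintegral_indicator_one hsub.measurableSet]
  exact Measure.absolutelyContinuous_of_le Measure.restrict_le_self (hsub.measure_zero volume)

lemma sum_setLIntegral_inter_gap {I : Set ℝ} (hI : MeasurableSet I) (Z : Finset ℝ)
    (f : ℝ → ENNReal) :
    ∑ j ∈ Finset.range (Z.card + 1), ∫⁻ x in I ∩ gap Z j, f x = ∫⁻ x in I, f x := by
  rw [← lintegral_biUnion_finset
    (fun i _ j _ hij => (pairwise_disjoint_gap Z hij).mono inter_subset_right inter_subset_right)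
    fun j _ => hI.inter (gap_ordConnected Z j).measurableSet, ← inter_iUnion₂, iUnion_gap,
    ← sdiff_eq]
  exact setLIntegral_congr (sdiff_null_ae_eq_self (Z.finite_toSet.measure_zero _))

lemma lintegral_rootCount_add_C {I : Set ℝ} (hI : I.OrdConnected) (h : ℝ[X]) :
    ∫⁻ t in Icc (-1 : ℝ) 1, (rootCount I (h + C t) : ENNReal) =
      ∫⁻ x in I, ENNReal.ofReal (densityKernel h x) := by
  simp only [← monomial_zero_left]
  by_cases hcrit : critPoly h 0 = 0
  · rw [eq_monomial_of_critPoly_eq_zero hcrit]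
    simp only [← map_add, rootCount_monomial]
    simp [densityKernel]
  have hgap : ∀ j, (I ∩ gap (critSet h 0) j).OrdConnected := fun j =>
    hI.inter (gap_ordConnected _ _)
  have hgap0 : ∀ j, 0 ∉ I ∩ gap (critSet h 0) j := fun j h0 =>
    zero_notMem_gap_critSet h 0 j h0.2
  have hmeas : ∀ j, MeasurableSet (rootParams h 0 (I ∩ gap (critSet h 0) j)) := fun j =>
    (ordConnected_rootParams h 0 (hgap j) (hgap0 j)).measurableSet
  have hinj : ∀ j, InjOn (fun x => h.eval x) (I ∩ gap (critSet h 0) j) := fun j => by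
    simpa only [pow_zero, div_one] using (injOn_eval_div_pow_gap hcrit j).mono inter_subset_right
  simp only [rootCount_add_monomial_eq_sum ENNReal I hcrit]
  rw [lintegral_add_left
      (Finset.measurable_fun_sum _ fun j _ => measurable_one.indicator (hmeas j)),
    lintegral_finsetSum _ fun j _ => measurable_one.indicator (hmeas j),
    ← sum_setLIntegral_inter_gap hI.measurableSet (critSet h 0)]
  have hcritical : ∫⁻ t in Icc (-1 : ℝ) 1, ∑ z ∈ critSet h 0,
      (rootParams h 0 (I ∩ {z})).indicator 1 t = (0 : ENNReal) := by
    rw [lintegral_finsetSum]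
    · exact Finset.sum_eq_zero fun z _ => lintegral_rootParams_singleton h I _ z
    · exact fun z _ => measurable_one.indicator (ordConnected_rootParams_of_subsingleton h 0
        (subsingleton_singleton.anti inter_subset_right)).measurableSet
  rw [hcritical, add_zero]
  refine Finset.sum_congr rfl fun j _ => ?_
  rw [lintegral_indicator_one (hmeas j), Measure.restrict_apply (hmeas j),
    volume_rootParams_inter_Icc (hgap j).measurableSet (hgap0 j) (hinj j)]

/-- The density of roots at `x` of the polynomials of degree at most `n` with coefficients in
`[-1, 1]`: such a polynomial is `t + X b` with `b` of degree less than `n`, and `t` is integrated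
out. -/
noncomputable def rootDensity (n : ℕ) (x : ℝ) : ℝ :=
  ∫ b in box n 1, densityKernel (X * ofFn n b) x

lemma continuous_eval_X_mul_ofFn (n : ℕ) :
    Continuous fun q : (Fin n → ℝ) × ℝ => (X * ofFn n q.1).eval q.2 := by
  simp only [eval_mul, eval_X]
  exact continuous_snd.mul (continuous_eval_ofFn n)

lemma continuous_eval_derivative_X_mul_ofFn (n : ℕ) :
    Continuous fun q : (Fin n → ℝ) × ℝ => (derivative (X * ofFn n q.1)).eval q.2 := by
  simp only [ofFn_eq_sum_monomial, Finset.mul_sum, X_mul_monomial, derivative_sum,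
    derivative_monomial, eval_finsetSum, eval_monomial]
  fun_prop

lemma measurable_densityKernel (n : ℕ) :
    Measurable fun q : (Fin n → ℝ) × ℝ => densityKernel (X * ofFn n q.1) q.2 :=
  Measurable.ite
    (measurableSet_le (continuous_eval_X_mul_ofFn n).abs.measurable measurable_const)
    (continuous_eval_derivative_X_mul_ofFn n).abs.measurable measurable_const

lemma integrableOn_densityKernel (n : ℕ) (x : ℝ) :
    IntegrableOn (fun b : Fin n → ℝ => densityKernel (X * ofFn n b) x) (box n 1) := by
  obtain ⟨B, hB⟩ := (isCompact_box n 1).exists_bound_of_continuousOn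
    ((continuous_eval_derivative_X_mul_ofFn n).comp (Continuous.prodMk_left x)).continuousOn
  refine Integrable.of_bound
    ((measurable_densityKernel n).comp measurable_prodMk_right).aestronglyMeasurable B ?_
  exact (ae_restrict_mem (isCompact_box n 1).measurableSet).mono fun b hb =>
    (norm_densityKernel_le _ x).trans (hB b hb)

lemma rootDensity_nonneg (n : ℕ) (x : ℝ) : 0 ≤ rootDensity n x :=
  integral_nonneg fun _ => densityKernel_nonneg _ x

lemma ofReal_rootDensity (n : ℕ) (x : ℝ) :
    ENNReal.ofReal (rootDensity n x) =
      ∫⁻ b in box n 1, ENNReal.ofReal (densityKernel (X * ofFn n b) x) :=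
  ofReal_integral_eq_lintegral_ofReal (integrableOn_densityKernel n x)
    (Eventually.of_forall fun _ => densityKernel_nonneg _ x)

lemma ofReal_rootVolume {I : Set ℝ} (hI : I.OrdConnected) (m : ℕ) :
    ENNReal.ofReal (rootVolume m I) = ∫⁻ a in box m 1, (rootCount I (ofFn m a) : ENNReal) := by
  rw [rootVolume, ofReal_integral_eq_lintegral_ofReal
    (integrableOn_box (measurable_rootCount_real hI m) (abs_rootCount_ofFn_le I) 1)
    (Eventually.of_forall fun _ => Nat.cast_nonneg _)]
  simp only [ENNReal.ofReal_natCast]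

lemma lintegral_rootDensity {I : Set ℝ} (hI : I.OrdConnected) (n : ℕ) :
    ∫⁻ x in I, ENNReal.ofReal (rootDensity n x) = ENNReal.ofReal (rootVolume (n + 1) I) := by
  rw [ofReal_rootVolume hI,
    lintegral_box_succ (f := fun a => (rootCount I (ofFn (n + 1) a) : ENNReal))
      (measurable_from_top.comp (measurable_rootCount hI (n + 1)))]
  simp only [ofFn_cons, lintegral_rootCount_add_C hI, ofReal_rootDensity]
  rw [lintegral_lintegral_swap]
  exact ((measurable_densityKernel n).ennreal_ofReal.comp measurable_swap).aemeasurable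

lemma ae_linearMap_ne {E : Type*} [NormedAddCommGroup E] [NormedSpace ℝ E] [MeasurableSpace E]
    [BorelSpace E] [FiniteDimensional ℝ E] (μ : Measure E) [μ.IsAddHaarMeasure]
    {L : E →ₗ[ℝ] ℝ} (hL : L ≠ 0) (c : ℝ) : ∀ᵐ b ∂μ, L b ≠ c := by
  obtain ⟨v, hv⟩ := LinearMap.surjective hL c
  have hset : {b | L b = c} = (fun b => b + -v) ⁻¹' (LinearMap.ker L : Set E) := by
    ext b
    rw [mem_preimage, SetLike.mem_coe, LinearMap.mem_ker, map_add, map_neg, hv,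
      add_neg_eq_zero, mem_ofPred_eq]
  have hnull : μ {b | L b = c} = 0 := by
    rw [hset, measure_preimage_add_right]
    exact Measure.addHaar_submodule _ _ fun hker => hL (LinearMap.ker_eq_top.1 hker)
  exact measure_eq_zero_iff_ae_notMem.1 hnull

lemma ae_abs_linearMap_ne_one {E : Type*} [NormedAddCommGroup E] [NormedSpace ℝ E]
    [MeasurableSpace E] [BorelSpace E] [FiniteDimensional ℝ E] (μ : Measure E)
    [μ.IsAddHaarMeasure] (L : E →ₗ[ℝ] ℝ) : ∀ᵐ b ∂μ, |L b| ≠ 1 := by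
  rcases eq_or_ne L 0 with rfl | hL
  · simp
  filter_upwards [ae_linearMap_ne μ hL 1, ae_linearMap_ne μ hL (-1)] with b hpos hneg habs
  exact (eq_or_eq_neg_of_abs_eq habs).elim hpos hneg

lemma continuousAt_densityKernel {h : ℝ[X]} {x : ℝ} (hx : |h.eval x| ≠ 1) :
    ContinuousAt (densityKernel h) x := by
  have hcont : ContinuousAt (fun y => |h.eval y|) x := h.continuous.abs.continuousAt
  rcases hx.lt_or_gt with hlt | hgt
  · refine (derivative h).continuous.abs.continuousAt.congr ?_
    filter_upwards [hcont.eventually_lt_const hlt] with y hy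
    rw [densityKernel, if_pos hy.le]
  · refine (continuousAt_const (y := (0 : ℝ))).congr ?_
    filter_upwards [hcont.eventually_const_lt hgt] with y hy
    rw [densityKernel, if_neg hy.not_ge]

lemma continuous_rootDensity (n : ℕ) : Continuous (rootDensity n) := by
  refine continuous_iff_continuousAt.2 fun x => ?_
  obtain ⟨B, hB⟩ :=
    ((isCompact_box n 1).prod (isCompact_closedBall x 1)).exists_bound_of_continuousOn
      (continuous_eval_derivative_X_mul_ofFn n).continuousOn
  refine continuousAt_of_dominated (bound := fun _ => B) ?_ ?_ (integrable_const _) ?_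
  · exact Eventually.of_forall fun y =>
      ((measurable_densityKernel n).comp measurable_prodMk_right).aestronglyMeasurable
  · filter_upwards [Metric.closedBall_mem_nhds x one_pos] with y hy
    exact (ae_restrict_mem (isCompact_box n 1).measurableSet).mono fun b hb =>
      (norm_densityKernel_le _ y).trans (hB (b, y) ⟨hb, hy⟩)
  · have hnull := ae_abs_linearMap_ne_one (volume : Measure (Fin n → ℝ))
      (leval x ∘ₗ LinearMap.mulLeft ℝ X ∘ₗ ofFn n)
    exact ae_restrict_of_ae (hnull.mono fun b hb => continuousAt_densityKernel hb)

lemma integrable_rootDensity (n : ℕ) : Integrable (rootDensity n) := by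
  refine ⟨(continuous_rootDensity n).aestronglyMeasurable, ?_⟩
  rw [hasFiniteIntegral_iff_ofReal (Eventually.of_forall (rootDensity_nonneg n)),
    ← setLIntegral_univ, lintegral_rootDensity ordConnected_univ]
  exact ENNReal.ofReal_lt_top

lemma setIntegral_rootDensity {I : Set ℝ} (hI : I.OrdConnected) (n : ℕ) :
    ∫ x in I, rootDensity n x = rootVolume (n + 1) I := by
  rw [integral_eq_lintegral_of_nonneg_ae (Eventually.of_forall (rootDensity_nonneg n))
    (continuous_rootDensity n).aestronglyMeasurable, lintegral_rootDensity hI,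
    ENNReal.toReal_ofReal (rootVolume_nonneg _ _)]

lemma densityKernel_X_mul_ofFn_zero {n : ℕ} (b : Fin (n + 1) → ℝ) :
    densityKernel (X * ofFn (n + 1) b) 0 = |b 0| := by
  have hb : (ofFn (n + 1) b).coeff 0 = b 0 := ofFn_coeff_fin b 0
  simp [densityKernel, derivative_mul, ← coeff_zero_eq_eval_zero, hb]

lemma rootDensity_zero_pos {n : ℕ} (hn : n ≠ 0) : 0 < rootDensity n 0 := by
  obtain ⟨n, rfl⟩ := Nat.exists_eq_succ_of_ne_zero hn
  have hproj : (LinearMap.proj 0 : (Fin (n + 1) → ℝ) →ₗ[ℝ] ℝ) ≠ 0 := fun h => by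
    simpa using LinearMap.congr_fun h 1
  refine (rootDensity_nonneg _ _).lt_of_ne' fun hzero => ?_
  have hae := (setIntegral_eq_zero_iff_of_nonneg_ae
    (Eventually.of_forall fun _ => densityKernel_nonneg _ 0)
    (integrableOn_densityKernel (n + 1) 0)).1 hzero
  have hfalse : ∀ᵐ _b ∂volume.restrict (box (n + 1) 1), False := by
    filter_upwards [hae, ae_restrict_of_ae (ae_linearMap_ne volume hproj 0)] with b hb hb0
    rw [densityKernel_X_mul_ofFn_zero] at hb
    exact hb0 (abs_eq_zero.1 hb)
  have hvol := volume_real_box (n + 1) zero_le_one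
  rw [measureReal_def, Measure.restrict_eq_zero.1 (ae_eq_bot.1
    (eventually_false_iff_eq_bot.1 hfalse)), ENNReal.toReal_zero, mul_one] at hvol
  exact (by positivity : (0 : ℝ) ≠ 2 ^ (n + 1)) hvol

lemma rootVolume_le_univ (n : ℕ) {I : Set ℝ} (hI : I.OrdConnected) :
    rootVolume (n + 1) I ≤ rootVolume (n + 1) univ := by
  rw [← setIntegral_rootDensity hI, ← setIntegral_rootDensity ordConnected_univ,
    setIntegral_univ]
  exact setIntegral_le_integral (integrable_rootDensity n)
    (Eventually.of_forall (rootDensity_nonneg n))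

lemma rootVolume_univ_pos {n : ℕ} (hn : n ≠ 0) : 0 < rootVolume (n + 1) univ := by
  rw [← setIntegral_rootDensity ordConnected_univ, setIntegral_univ,
    integral_pos_iff_support_of_nonneg (rootDensity_nonneg n) (integrable_rootDensity n)]
  exact (continuous_rootDensity n).isOpen_support.measure_pos _ ⟨0, (rootDensity_zero_pos hn).ne'⟩

lemma hasDerivAt_rootVolume_Iic (n : ℕ) (x : ℝ) :
    HasDerivAt (fun y => rootVolume (n + 1) (Iic y)) (rootDensity n x) x := by
  have hprimitive : (fun y => rootVolume (n + 1) (Iic y)) =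
      fun y => rootVolume (n + 1) (Iic 0) + ∫ u in (0 : ℝ)..y, rootDensity n u := by
    funext y
    have hint := integrable_rootDensity n
    rw [← intervalIntegral.integral_Iic_sub_Iic hint.integrableOn hint.integrableOn,
      setIntegral_rootDensity ordConnected_Iic, setIntegral_rootDensity ordConnected_Iic,
      add_sub_cancel]
  rw [hprimitive]
  exact ((continuous_rootDensity n).integral_hasStrictDerivAt 0 x).hasDerivAt.const_add _

/-! ### Primitive polynomials -/

section

open scoped ArithmeticFunction.Moebius

lemma isPrimitive_ofFn_iff {m : ℕ} (a : Fin m → ℤ) :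
    (ofFn m a).IsPrimitive ↔ (Finset.univ.gcd a).natAbs = 1 := by
  have hdvd : ∀ r : ℤ, C r ∣ ofFn m a ↔ r ∣ Finset.univ.gcd a := by
    intro r
    rw [C_dvd_iff_dvd_coeff, Finset.dvd_gcd_iff]
    refine ⟨fun h i _ => ofFn_coeff_fin a i ▸ h i, fun h j => ?_⟩
    rcases lt_or_ge j m with hj | hj
    · rw [ofFn_coeff_eq_val_of_lt a hj]
      exact h ⟨j, hj⟩ (Finset.mem_univ _)
    · rw [ofFn_coeff_eq_zero_of_ge a hj]
      exact dvd_zero r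
  rw [← Int.isUnit_iff_natAbs_eq]
  exact ⟨fun h => h _ ((hdvd _).2 dvd_rfl), fun h r hr => isUnit_of_dvd_unit ((hdvd r).1 hr) h⟩

/-- The total number of roots in `I` of the primitive integer polynomials of degree less than `m`
and height at most `Q`. -/
noncomputable def primitiveCount (m : ℕ) (I : Set ℝ) (Q : ℝ) : ℝ :=
  ∑ a ∈ (intBox m Q).filter (fun a => (ofFn m a).IsPrimitive),
    (rootCount I (ofFn m fun i => (a i : ℝ)) : ℝ)

lemma latticeCount_div (m : ℕ) (I : Set ℝ) (Q : ℝ) {d : ℕ} (hd : 0 < d) :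
    latticeCount m I (Q / d) =
      ∑ a ∈ (intBox m Q).filter (fun a => d ∣ (Finset.univ.gcd a).natAbs),
        (rootCount I (ofFn m fun i => (a i : ℝ)) : ℝ) := by
  have hd' : (0 : ℝ) < d := Nat.cast_pos.2 hd
  have hdvd : ∀ a : Fin m → ℤ, d ∣ (Finset.univ.gcd a).natAbs ↔ ∀ i, (d : ℤ) ∣ a i := by
    intro a
    rw [← Int.natCast_dvd, Finset.dvd_gcd_iff]
    simp only [Finset.mem_univ, true_imp_iff]
  have hmem : ∀ b : Fin m → ℤ, b ∈ intBox m (Q / d) ↔ (fun i => d * b i) ∈ intBox m Q := by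
    intro b
    simp only [mem_intBox, le_div_iff₀ hd', Int.cast_mul, Int.cast_natCast, abs_mul, Nat.abs_cast,
      mul_comm]
  refine Finset.sum_nbij (fun b i => d * b i) (fun b hb => ?_) (fun b _ c _ hbc => ?_)
    (fun a ha => ?_) (fun b _ => ?_)
  · exact Finset.mem_filter.2 ⟨(hmem b).1 hb, (hdvd _).2 fun i => dvd_mul_right _ _⟩
  · exact funext fun i => mul_left_cancel₀ (Nat.cast_ne_zero.2 hd.ne') (congrFun hbc i)
  · rw [Finset.mem_coe, Finset.mem_filter, hdvd] at ha
    choose b hb using ha.2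
    exact ⟨b, (hmem b).2 (funext hb ▸ ha.1), (funext hb).symm⟩
  · have hsmul : (fun i => (((d : ℤ) * b i : ℤ) : ℝ)) = (d : ℝ) • fun i => (b i : ℝ) := by
      funext i
      simp
    rw [hsmul, rootCount_ofFn_smul I hd'.ne']

lemma sum_range_moebius_dvd {N D : ℕ} (hN : N ≠ 0) (hD : N < D) :
    ∑ d ∈ (Finset.range D).filter (· ∣ N), (μ d : ℝ) = if N = 1 then 1 else 0 := by
  have hdiv : (Finset.range D).filter (· ∣ N) = N.divisors := by
    ext d
    rw [Finset.mem_filter, Finset.mem_range, Nat.mem_divisors]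
    exact ⟨fun h => ⟨h.2, hN⟩, fun h => ⟨(Nat.le_of_dvd (Nat.pos_of_ne_zero hN) h.1).trans_lt hD,
      h.1⟩⟩
  have hinv := DFunLike.congr_fun ArithmeticFunction.moebius_mul_coe_zeta N
  rw [ArithmeticFunction.coe_mul_zeta_apply, ArithmeticFunction.one_apply] at hinv
  rw [hdiv]
  exact_mod_cast hinv

lemma gcd_natAbs_ne_zero {m : ℕ} {a : Fin m → ℤ} (ha : a ≠ 0) :
    (Finset.univ.gcd a).natAbs ≠ 0 := by
  rw [Int.natAbs_ne_zero, Ne, Finset.gcd_eq_zero_iff]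
  exact fun h => ha (funext fun i => h i (Finset.mem_univ i))

lemma gcd_natAbs_le_of_mem_intBox {m : ℕ} {Q : ℝ} {a : Fin m → ℤ} (ha : a ∈ intBox m Q)
    (ha0 : a ≠ 0) : ((Finset.univ.gcd a).natAbs : ℝ) ≤ Q := by
  obtain ⟨i, hi⟩ := Function.ne_iff.1 ha0
  have hle : (Finset.univ.gcd a).natAbs ≤ (a i).natAbs :=
    Nat.le_of_dvd (Int.natAbs_pos.2 hi)
      (Int.natAbs_dvd_natAbs.2 (Finset.gcd_dvd (Finset.mem_univ i)))
  have hai := mem_intBox.1 ha i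
  rw [← Int.cast_abs, Int.abs_eq_natAbs, Int.cast_natCast] at hai
  exact (Nat.cast_le.2 hle).trans hai

lemma primitiveCount_eq_sum_moebius (m : ℕ) (I : Set ℝ) {Q : ℝ} {D : ℕ} (hD : Q < D) :
    primitiveCount m I Q = ∑ d ∈ Finset.range D, (μ d : ℝ) * latticeCount m I (Q / d) := by
  have hterm : ∀ d : ℕ, (μ d : ℝ) * latticeCount m I (Q / d) = ∑ a ∈ intBox m Q,
      if d ∣ (Finset.univ.gcd a).natAbs then
        (rootCount I (ofFn m fun i => (a i : ℝ)) : ℝ) * (μ d : ℝ) else 0 := by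
    intro d
    rcases Nat.eq_zero_or_pos d with rfl | hd
    · simp
    · rw [latticeCount_div m I Q hd, ← Finset.sum_filter, ← Finset.sum_mul, mul_comm]
  simp only [hterm]
  rw [Finset.sum_comm, primitiveCount, Finset.sum_filter]
  refine Finset.sum_congr rfl fun a ha => ?_
  rw [← Finset.sum_filter, ← Finset.mul_sum, isPrimitive_ofFn_iff]
  rcases eq_or_ne a 0 with rfl | ha0
  · have hcast : (fun i : Fin m => (((0 : Fin m → ℤ) i : ℤ) : ℝ)) = 0 := funext fun i => by simp
    rw [hcast, map_zero, rootCount_zero]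
    simp
  · rw [sum_range_moebius_dvd (gcd_natAbs_ne_zero ha0)
      (Nat.cast_lt.1 ((gcd_natAbs_le_of_mem_intBox ha ha0).trans_lt hD))]
    split_ifs <;> simp

/-- The proportion `∑ μ(d) / d ^ k = 1 / ζ(k)` of primitive vectors in `ℤ ^ k`. -/
noncomputable def primitiveDensity (k : ℕ) : ℝ := ∑' d : ℕ, (μ d : ℝ) / (d : ℝ) ^ k

lemma abs_moebius_cast_le_one (d : ℕ) : |(μ d : ℝ)| ≤ 1 := by
  exact_mod_cast ArithmeticFunction.abs_moebius_le_one (n := d)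

lemma abs_moebius_div_pow_le (k d : ℕ) : |(μ d : ℝ) / (d : ℝ) ^ k| ≤ 1 / (d : ℝ) ^ k := by
  rw [abs_div, abs_of_nonneg (by positivity : (0 : ℝ) ≤ (d : ℝ) ^ k)]
  gcongr
  exact abs_moebius_cast_le_one d

lemma summable_moebius_div_pow {k : ℕ} (hk : 2 ≤ k) :
    Summable fun d : ℕ => (μ d : ℝ) / (d : ℝ) ^ k :=
  Summable.of_norm_bounded (Real.summable_one_div_nat_pow.2 hk) (abs_moebius_div_pow_le k)

/- The terms with `d ≥ 2` contribute at least `-(ζ(2) - 1) > -1`. -/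
lemma primitiveDensity_pos {k : ℕ} (hk : 2 ≤ k) : 0 < primitiveDensity k := by
  have hone : HasSum (fun d : ℕ => if d = 1 then (1 : ℝ) else 0) 1 := hasSum_ite_eq 1 1
  have hterm : ∀ d : ℕ, -((1 : ℝ) / (d : ℝ) ^ 2 - if d = 1 then (1 : ℝ) else 0) ≤
      (μ d : ℝ) / (d : ℝ) ^ k - if d = 1 then (1 : ℝ) else 0 := by
    intro d
    rcases eq_or_ne d 1 with rfl | hd
    · simp
    rw [if_neg hd, sub_zero, sub_zero]
    refine (neg_le_neg ?_).trans (neg_le_of_abs_le (abs_moebius_div_pow_le k d))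
    rcases Nat.eq_zero_or_pos d with rfl | hpos
    · simp [show k ≠ 0 by omega]
    · gcongr
      exact_mod_cast hpos
  have htail := hasSum_le hterm (hasSum_zeta_two.sub hone).neg
    ((summable_moebius_div_pow hk).hasSum.sub hone)
  have hzeta : Real.pi ^ 2 / 6 < 2 := by nlinarith [Real.pi_lt_d2, Real.pi_pos]
  unfold primitiveDensity
  linarith

lemma abs_primitiveCount_sub_sum_le {n : ℕ} (hn : 2 ≤ n) {I : Set ℝ} {V B Q : ℝ} (hB : 0 ≤ B)
    (hQ : 0 < Q)
    (hI : ∀ R : ℝ, 0 < R → |latticeCount (n + 1) I R - R ^ (n + 1) * V| ≤ B * R ^ n) {D : ℕ}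
    (hD : Q < D) :
    |primitiveCount (n + 1) I Q -
      (∑ d ∈ Finset.range D, (μ d : ℝ) / (d : ℝ) ^ (n + 1)) * V * Q ^ (n + 1)| ≤
        B * (∑' d : ℕ, 1 / (d : ℝ) ^ n) * Q ^ n := by
  have hsum : Summable fun d : ℕ => 1 / (d : ℝ) ^ n := Real.summable_one_div_nat_pow.2 hn
  have hterm : ∀ d : ℕ, |(μ d : ℝ) * latticeCount (n + 1) I (Q / d) -
      (μ d : ℝ) / (d : ℝ) ^ (n + 1) * V * Q ^ (n + 1)| ≤ B * Q ^ n * (1 / (d : ℝ) ^ n) := by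
    intro d
    rcases Nat.eq_zero_or_pos d with rfl | hd
    · simp [show n ≠ 0 by omega]
    calc _ = |(μ d : ℝ)| *
            |latticeCount (n + 1) I (Q / d) - (Q / d) ^ (n + 1) * V| := by
          rw [← abs_mul, div_pow]
          ring_nf
      _ ≤ 1 * (B * (Q / d) ^ n) := by
          gcongr
          · exact abs_moebius_cast_le_one d
          · exact hI _ (by positivity)
      _ = _ := by rw [div_pow]; ring
  rw [primitiveCount_eq_sum_moebius _ _ hD, Finset.sum_mul, Finset.sum_mul,
    ← Finset.sum_sub_distrib]
  calc _ ≤ ∑ d ∈ Finset.range D, B * Q ^ n * (1 / (d : ℝ) ^ n) :=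
        (Finset.abs_sum_le_sum_abs _ _).trans (Finset.sum_le_sum fun d _ => hterm d)
    _ ≤ B * Q ^ n * ∑' d : ℕ, 1 / (d : ℝ) ^ n := by
        rw [← Finset.mul_sum]
        gcongr
        exact hsum.sum_le_tsum _ fun d _ => by positivity
    _ = _ := by ring

lemma exists_abs_primitiveCount_sub_le {n : ℕ} (hn : 2 ≤ n) : ∃ C : ℝ, 0 ≤ C ∧
    ∀ I : Set ℝ, I.OrdConnected → ∀ Q : ℝ, 0 < Q →
      |primitiveCount (n + 1) I Q -
        primitiveDensity (n + 1) * rootVolume (n + 1) I * Q ^ (n + 1)| ≤ C * Q ^ n := by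
  obtain ⟨B, hB, hcount⟩ := exists_abs_latticeCount_sub_le n
  refine ⟨B * ∑' d : ℕ, 1 / (d : ℝ) ^ n, mul_nonneg hB (tsum_nonneg fun d => by positivity),
    fun I hI Q hQ => ?_⟩
  have hpartial := (summable_moebius_div_pow (by omega : 2 ≤ n + 1)).hasSum.tendsto_sum_nat
  refine le_of_tendsto (((hpartial.mul_const (rootVolume (n + 1) I)).mul_const
    (Q ^ (n + 1))).const_sub (primitiveCount (n + 1) I Q)).abs ?_
  filter_upwards [tendsto_natCast_atTop_atTop.eventually_gt_atTop Q] with D hD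
  exact abs_primitiveCount_sub_sum_le hn hB hQ (hcount I hI) hD

end

/-! ### The error term -/

/-- The error term `Q ^ n (1 + log Q) ^ ℓ(n)` in the counting results of degree `n`; it is used for
`Q ≥ 1`, and the summand `1` makes it positive at `Q = 1`. -/
noncomputable def errorTerm (n : ℕ) (Q : ℝ) : ℝ := Q ^ n * (1 + Real.log Q) ^ ell n

section errorTerm

variable (n : ℕ) {Q R : ℝ}

lemma errorTerm_nonneg (hQ : 1 ≤ Q) : 0 ≤ errorTerm n Q := by
  have hlog := Real.log_nonneg hQ
  rw [errorTerm]
  positivity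

lemma pow_le_errorTerm (hQ : 1 ≤ Q) : Q ^ n ≤ errorTerm n Q :=
  le_mul_of_one_le_right (by positivity) (one_le_pow₀ (by linarith [Real.log_nonneg hQ]))

lemma errorTerm_mono (hQ : 1 ≤ Q) (hQR : Q ≤ R) : errorTerm n Q ≤ errorTerm n R := by
  have hlogQ := Real.log_nonneg hQ
  have hlog := Real.log_le_log (by linarith) hQR
  have hR : 0 ≤ R := by linarith
  rw [errorTerm, errorTerm]
  gcongr

lemma errorTerm_mul_le (hQ : 1 ≤ Q) (hR : 1 ≤ R) :
    errorTerm n (Q * R) ≤ errorTerm n Q * errorTerm n R := by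
  have hlogQ := Real.log_nonneg hQ
  have hlogR := Real.log_nonneg hR
  have hlog : 1 + Real.log (Q * R) ≤ (1 + Real.log Q) * (1 + Real.log R) := by
    rw [Real.log_mul (by linarith) (by linarith)]
    nlinarith
  have hlog_nonneg : 0 ≤ Real.log (Q * R) := Real.log_nonneg (one_le_mul_of_one_le_of_one_le hQ hR)
  calc errorTerm n (Q * R) ≤ (Q * R) ^ n * ((1 + Real.log Q) * (1 + Real.log R)) ^ ell n := by
        rw [errorTerm]
        gcongr
    _ = errorTerm n Q * errorTerm n R := by
        rw [errorTerm, errorTerm, mul_pow, mul_pow]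
        ring

lemma tendsto_errorTerm_div :
    Tendsto (fun Q => errorTerm n Q / Q ^ (n + 1)) atTop (𝓝 0) := by
  have hell : ell n ≤ 1 := by
    rw [ell]
    split_ifs <;> simp
  have hlog : Tendsto (fun Q : ℝ => Q⁻¹ + Real.log Q / Q) atTop (𝓝 0) := by
    simpa only [add_zero, id_eq] using
      tendsto_inv_atTop_zero.add Real.isLittleO_log_id_atTop.tendsto_div_nhds_zero
  refine squeeze_zero' ?_ ?_ hlog
  · filter_upwards [eventually_ge_atTop 1] with Q hQ
    exact div_nonneg (errorTerm_nonneg n hQ) (by positivity)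
  · filter_upwards [eventually_ge_atTop 1] with Q hQ
    have : 0 < Q := by linarith
    calc errorTerm n Q / Q ^ (n + 1) = (1 + Real.log Q) ^ ell n / Q := by
          rw [errorTerm, pow_succ, mul_div_mul_left _ _ (by positivity)]
      _ ≤ (1 + Real.log Q) ^ 1 / Q := by
          gcongr
          linarith [Real.log_nonneg hQ]
      _ = Q⁻¹ + Real.log Q / Q := by rw [pow_one, add_div, one_div]

end errorTerm

/-! ### The height of an integer polynomial -/

lemma polyHeight_neg (p : ℤ[X]) : polyHeight (-p) = polyHeight p := by
  simp [polyHeight]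

lemma natAbs_coeff_le_polyHeight (p : ℤ[X]) (i : ℕ) : (p.coeff i).natAbs ≤ polyHeight p := by
  by_cases hi : i ∈ p.support
  · exact Finset.le_sup (f := fun i => (p.coeff i).natAbs) hi
  · simp [notMem_support_iff.1 hi]

lemma abs_coeff_le_polyHeight (p : ℤ[X]) (i : ℕ) : |(p.coeff i : ℝ)| ≤ polyHeight p := by
  rw [← Int.cast_abs, ← Nat.cast_natAbs]
  exact Nat.cast_le.2 (natAbs_coeff_le_polyHeight p i)

lemma exists_natAbs_coeff_eq_polyHeight (p : ℤ[X]) : ∃ i, (p.coeff i).natAbs = polyHeight p := by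
  rcases eq_or_ne p 0 with rfl | hp
  · exact ⟨0, by simp [polyHeight]⟩
  · obtain ⟨i, -, hi⟩ := p.support.exists_mem_eq_sup (nonempty_support_iff.2 hp)
      fun i => (p.coeff i).natAbs
    exact ⟨i, hi.symm⟩

lemma polyHeight_le_iff {p : ℤ[X]} {Q : ℝ} :
    (polyHeight p : ℝ) ≤ Q ↔ ∀ i, |(p.coeff i : ℝ)| ≤ Q := by
  refine ⟨fun h i => (abs_coeff_le_polyHeight p i).trans h, fun h => ?_⟩
  obtain ⟨i, hi⟩ := exists_natAbs_coeff_eq_polyHeight p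
  rw [← hi, Nat.cast_natAbs, Int.cast_abs]
  exact h i

lemma polyHeight_pos {p : ℤ[X]} (hp : p ≠ 0) : 0 < polyHeight p :=
  (Int.natAbs_pos.2 (leadingCoeff_ne_zero.2 hp)).trans_le (natAbs_coeff_le_polyHeight p _)

lemma polyHeight_ofFn_le_iff {m : ℕ} {a : Fin m → ℤ} {Q : ℝ} (hQ : 0 ≤ Q) :
    (polyHeight (ofFn m a) : ℝ) ≤ Q ↔ a ∈ intBox m Q := by
  rw [polyHeight_le_iff, mem_intBox]
  refine ⟨fun h i => ofFn_coeff_fin a i ▸ h i, fun h i => ?_⟩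
  rcases lt_or_ge i m with hi | hi
  · rw [ofFn_coeff_eq_val_of_lt a hi]
    exact h ⟨i, hi⟩
  · simpa [ofFn_coeff_eq_zero_of_ge a hi] using hQ

lemma exists_natAbs_eq_polyHeight_ofFn {m : ℕ} {a : Fin m → ℤ} (ha : polyHeight (ofFn m a) ≠ 0) :
    ∃ i, (a i).natAbs = polyHeight (ofFn m a) := by
  obtain ⟨i, hi⟩ := exists_natAbs_coeff_eq_polyHeight (ofFn m a)
  rcases lt_or_ge i m with him | him
  · rw [ofFn_coeff_eq_val_of_lt a him] at hi
    exact ⟨⟨i, him⟩, hi⟩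
  · rw [ofFn_coeff_eq_zero_of_ge a him, Int.natAbs_zero] at hi
    exact absurd hi.symm ha

lemma polyHeight_le_two_pow_mul_mahlerMeasure (p : ℤ[X]) :
    (polyHeight p : ℝ) ≤ 2 ^ p.natDegree * (p.map (Int.castRingHom ℂ)).mahlerMeasure := by
  rw [polyHeight_le_iff]
  intro i
  have hcoeff := norm_coeff_le_choose_mul_mahlerMeasure i (p.map (Int.castRingHom ℂ))
  rw [natDegree_map_eq_of_injective (RingHom.injective_int _), coeff_map, eq_intCast,
    Complex.norm_intCast] at hcoeff
  refine hcoeff.trans (mul_le_mul_of_nonneg_right ?_ (mahlerMeasure_nonneg _))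
  exact_mod_cast Nat.choose_le_two_pow _ _

lemma mahlerMeasure_le_mul_polyHeight (p : ℤ[X]) :
    (p.map (Int.castRingHom ℂ)).mahlerMeasure ≤ (p.natDegree + 1) * polyHeight p := by
  refine (mahlerMeasure_le_sum_norm_coeff _).trans ?_
  rw [sum_over_range _ fun _ => norm_zero, natDegree_map_eq_of_injective (RingHom.injective_int _)]
  calc ∑ i ∈ Finset.range (p.natDegree + 1), ‖(p.map (Int.castRingHom ℂ)).coeff i‖
      ≤ ∑ _i ∈ Finset.range (p.natDegree + 1), (polyHeight p : ℝ) := by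
        gcongr with i
        rw [coeff_map, eq_intCast, Complex.norm_intCast]
        exact abs_coeff_le_polyHeight p i
    _ = (p.natDegree + 1) * polyHeight p := by simp

/- Gelfond's inequality: the Mahler measure is multiplicative and comparable to the height. -/
lemma polyHeight_mul_polyHeight_le {p q : ℤ[X]} (hpq : p * q ≠ 0) :
    (polyHeight p : ℝ) * polyHeight q ≤
      2 ^ (p * q).natDegree * ((p * q).natDegree + 1) * polyHeight (p * q) := by
  have hprod := mahlerMeasure_le_mul_polyHeight (p * q)
  rw [Polynomial.map_mul, mahlerMeasure_mul] at hprod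
  set Mp := (p.map (Int.castRingHom ℂ)).mahlerMeasure
  set Mq := (q.map (Int.castRingHom ℂ)).mahlerMeasure
  calc (polyHeight p : ℝ) * polyHeight q
      ≤ (2 ^ p.natDegree * Mp) * (2 ^ q.natDegree * Mq) := by
        exact mul_le_mul (polyHeight_le_two_pow_mul_mahlerMeasure p)
          (polyHeight_le_two_pow_mul_mahlerMeasure q) (by positivity)
          (mul_nonneg (by positivity) (mahlerMeasure_nonneg _))
    _ = 2 ^ (p * q).natDegree * (Mp * Mq) := by
        rw [natDegree_mul (left_ne_zero_of_mul hpq) (right_ne_zero_of_mul hpq), pow_add]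
        ring
    _ ≤ 2 ^ (p * q).natDegree * (((p * q).natDegree + 1) * polyHeight (p * q)) := by gcongr
    _ = _ := by ring

/-! ### Reducible polynomials -/

lemma card_filter_coord_eq_le {k : ℕ} (Q : ℝ) (i : Fin (k + 1)) (v : ℤ) :
    ((intBox (k + 1) Q).filter (fun b => b i = v)).card ≤ (intBox k Q).card := by
  refine Finset.card_le_card_of_injOn i.removeNth (fun b hb => ?_) (fun b hb c hc hbc => ?_)
  · have hbox := mem_intBox.1 (Finset.mem_filter.1 hb).1
    exact mem_intBox.2 fun j => hbox _
  · rw [← Fin.insertNth_self_removeNth i b, ← Fin.insertNth_self_removeNth i c,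
      (Finset.mem_filter.1 hb).2, (Finset.mem_filter.1 hc).2, hbc]

/-- The coefficient vectors of the integer polynomials of degree less than `k` and height exactly
`u`. -/
noncomputable def intSphere (k u : ℕ) : Finset (Fin k → ℤ) :=
  (intBox k u).filter fun b => polyHeight (ofFn k b) = u

lemma intSphere_subset {k u : ℕ} (hu : 1 ≤ u) :
    intSphere k u ⊆ Finset.univ.biUnion fun i => (intBox k u).filter (fun b => b i = u) ∪
      (intBox k u).filter (fun b => b i = -u) := by
  intro b hb
  obtain ⟨hbox, hheight⟩ := Finset.mem_filter.1 hb
  obtain ⟨i, hi⟩ := exists_natAbs_eq_polyHeight_ofFn (a := b) (by omega)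
  rw [hheight] at hi
  rw [Finset.mem_biUnion]
  refine ⟨i, Finset.mem_univ i, ?_⟩
  rw [Finset.mem_union, Finset.mem_filter, Finset.mem_filter]
  exact (Int.natAbs_eq (b i)).imp (fun h => ⟨hbox, hi ▸ h⟩) fun h => ⟨hbox, hi ▸ h⟩

lemma card_intSphere_le (k : ℕ) {u : ℕ} (hu : 1 ≤ u) :
    ((intSphere (k + 1) u).card : ℝ) ≤ 2 * (k + 1) * (3 * u) ^ k := by
  have hcard : (intSphere (k + 1) u).card ≤ (k + 1) * (2 * (intBox k u).card) := by
    refine (Finset.card_le_card (intSphere_subset hu)).trans ?_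
    refine (Finset.card_biUnion_le_card_mul _ _ (2 * (intBox k u).card) fun i _ => ?_).trans_eq
      (by rw [Finset.card_fin])
    rw [two_mul]
    exact (Finset.card_union_le _ _).trans
      (add_le_add (card_filter_coord_eq_le _ i _) (card_filter_coord_eq_le _ i _))
  calc ((intSphere (k + 1) u).card : ℝ) ≤ (k + 1) * (2 * (intBox k u).card) := by
        exact_mod_cast hcard
    _ ≤ (k + 1) * (2 * (3 * u) ^ k) := by
        gcongr
        exact card_intBox_le k (by exact_mod_cast hu)
    _ = _ := by ring

lemma pow_mul_div_pow_le {n k : ℕ} (hk : 1 ≤ k) (hkn : 2 * k ≤ n) (hn : 3 ≤ n) {u X : ℝ}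
    (hu : 1 ≤ u) (huX : u ≤ X) : u ^ k * (X / u) ^ (n - k + 1) ≤ X ^ n * (1 / u ^ 2) := by
  have : 0 < u := by linarith
  have hX0 : 0 < X := by linarith
  rw [div_pow, mul_one_div, ← mul_div_assoc, div_le_div_iff₀ (by positivity) (by positivity)]
  obtain ⟨j, rfl⟩ : ∃ j, k = j + 1 := ⟨k - 1, by omega⟩
  obtain ⟨l, rfl⟩ : ∃ l, n = j + 1 + l := ⟨n - (j + 1), by omega⟩
  have hl : 2 ≤ l := by omega
  rw [Nat.add_sub_cancel_left]
  calc u ^ (j + 1) * X ^ (l + 1) * u ^ 2 = X ^ (l + 1) * (u ^ j * u * u ^ 2) := by ring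
    _ ≤ X ^ (l + 1) * (X ^ j * u * u ^ l) := by gcongr
    _ = X ^ (j + 1 + l) * u ^ (l + 1) := by ring

lemma sum_pow_mul_div_pow_le {n k : ℕ} (hn : 2 ≤ n) (hk : 1 ≤ k) (hkn : 2 * k ≤ n) {X : ℝ}
    (hX : 1 ≤ X) : ∑ u ∈ Finset.Icc 1 ⌊X⌋₊, (u : ℝ) ^ k * (X / u) ^ (n - k + 1) ≤
      2 * errorTerm n X := by
  have hX0 : 0 < X := by linarith
  have hmem : ∀ u ∈ Finset.Icc 1 ⌊X⌋₊, (1 : ℝ) ≤ u ∧ (u : ℝ) ≤ X := by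
    intro u hu
    rw [Finset.mem_Icc] at hu
    exact ⟨by exact_mod_cast hu.1, (Nat.le_floor_iff hX0.le).1 hu.2⟩
  by_cases hn2 : n = 2
  · subst hn2
    obtain rfl : k = 1 := by omega
    calc _ = ∑ u ∈ Finset.Icc 1 ⌊X⌋₊, X ^ 2 * (u : ℝ)⁻¹ := by
          refine Finset.sum_congr rfl fun u hu => ?_
          have hu0 : (u : ℝ) ≠ 0 := by linarith [(hmem u hu).1]
          rw [pow_one, show 2 - 1 + 1 = 2 from rfl, div_pow]
          field_simp
      _ = X ^ 2 * (harmonic ⌊X⌋₊ : ℝ) := by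
          rw [harmonic_eq_sum_Icc]
          push_cast
          rw [Finset.mul_sum]
      _ ≤ X ^ 2 * (1 + Real.log X) := by
          gcongr
          exact harmonic_floor_le_one_add_log X hX
      _ = errorTerm 2 X := by rw [errorTerm, show ell 2 = 1 from rfl, pow_one]
      _ ≤ 2 * errorTerm 2 X := le_mul_of_one_le_left (errorTerm_nonneg 2 hX) one_le_two
  · calc _ ≤ ∑ u ∈ Finset.Icc 1 ⌊X⌋₊, X ^ n * (1 / (u : ℝ) ^ 2) :=
          Finset.sum_le_sum fun u hu =>
            pow_mul_div_pow_le hk hkn (by omega) (hmem u hu).1 (hmem u hu).2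
      _ = X ^ n * ∑ u ∈ Finset.Icc 1 ⌊X⌋₊, 1 / (u : ℝ) ^ 2 := by rw [Finset.mul_sum]
      _ ≤ X ^ n * 2 := by
          gcongr
          refine (hasSum_zeta_two.summable.sum_le_tsum _ fun d _ => by positivity).trans ?_
          rw [hasSum_zeta_two.tsum_eq]
          nlinarith [Real.pi_lt_d2, Real.pi_pos]
      _ = 2 * errorTerm n X := by rw [errorTerm, ell, if_neg hn2, pow_zero, mul_one, mul_comm]

/-- The pairs of coefficient vectors of integer polynomials of degrees at most `k` and `n - k`, the
first one nonzero, the product of whose heights is at most `X`; they are grouped by the height `u`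
of the first polynomial. -/
noncomputable def factorPairs (n k : ℕ) (X : ℝ) :
    Finset ((Fin (k + 1) → ℤ) × (Fin (n - k + 1) → ℤ)) :=
  (Finset.Icc 1 ⌊X⌋₊).biUnion fun u => intSphere (k + 1) u ×ˢ intBox (n - k + 1) (X / u)

lemma card_intSphere_mul_card_intBox_le {n k u : ℕ} (hkn : k ≤ n) {X : ℝ} (hu : 1 ≤ u)
    (huX : (u : ℝ) ≤ X) :
    ((intSphere (k + 1) u).card : ℝ) * (intBox (n - k + 1) (X / u)).card ≤
      2 * (n + 1) * 3 ^ (n + 1) * ((u : ℝ) ^ k * (X / u) ^ (n - k + 1)) := by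
  have hu0 : (0 : ℝ) < u := by exact_mod_cast hu
  obtain ⟨l, rfl⟩ := Nat.exists_eq_add_of_le hkn
  rw [Nat.add_sub_cancel_left]
  calc ((intSphere (k + 1) u).card : ℝ) * (intBox (l + 1) (X / u)).card
      ≤ (2 * (k + 1) * (3 * u) ^ k) * (3 * (X / u)) ^ (l + 1) := by
        gcongr
        · exact card_intSphere_le k hu
        · exact card_intBox_le (l + 1) ((one_le_div hu0).2 huX)
    _ = 2 * (k + 1) * 3 ^ (k + l + 1) * ((u : ℝ) ^ k * (X / u) ^ (l + 1)) := by
        rw [mul_pow, mul_pow]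
        ring
    _ ≤ _ := by
        have hX0 : 0 < X := hu0.trans_le huX
        gcongr

lemma card_factorPairs_le {n k : ℕ} (hn : 2 ≤ n) (hk : 1 ≤ k) (hkn : 2 * k ≤ n) {X : ℝ}
    (hX : 1 ≤ X) :
    ((factorPairs n k X).card : ℝ) ≤ 4 * (n + 1) * 3 ^ (n + 1) * errorTerm n X := by
  calc ((factorPairs n k X).card : ℝ)
      ≤ ∑ u ∈ Finset.Icc 1 ⌊X⌋₊,
          ((intSphere (k + 1) u).card : ℝ) * (intBox (n - k + 1) (X / u)).card := by
        have hcard := Finset.card_biUnion_le (s := Finset.Icc 1 ⌊X⌋₊)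
          (t := fun u => intSphere (k + 1) u ×ˢ intBox (n - k + 1) (X / u))
        simp only [Finset.card_product] at hcard
        exact_mod_cast hcard
    _ ≤ ∑ u ∈ Finset.Icc 1 ⌊X⌋₊,
          2 * (n + 1) * 3 ^ (n + 1) * ((u : ℝ) ^ k * (X / u) ^ (n - k + 1)) := by
        refine Finset.sum_le_sum fun u hu => ?_
        obtain ⟨hu1, huX⟩ := Finset.mem_Icc.1 hu
        exact card_intSphere_mul_card_intBox_le (by omega) hu1
          ((Nat.le_floor_iff (by linarith)).1 huX)
    _ ≤ 2 * (n + 1) * 3 ^ (n + 1) * (2 * errorTerm n X) := by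
        rw [← Finset.mul_sum]
        gcongr
        exact sum_pow_mul_div_pow_le hn hk hkn hX
    _ = _ := by ring

/-- The coefficient vectors of height at most `Q` of the integer polynomials of degree `n` that are
products of two nonconstant polynomials. -/
noncomputable def reducibleBox (n : ℕ) (Q : ℝ) : Finset (Fin (n + 1) → ℤ) :=
  (intBox (n + 1) Q).filter fun a => ∃ g h : ℤ[X], ofFn (n + 1) a = g * h ∧
    1 ≤ g.natDegree ∧ 1 ≤ h.natDegree ∧ g.natDegree + h.natDegree = n

lemma mk_toFn_mem_factorPairs {g h : ℤ[X]} {n : ℕ} {Q : ℝ} (hgh : g * h ≠ 0)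
    (hdeg : (g * h).natDegree = n) (hQ : (polyHeight (g * h) : ℝ) ≤ Q) :
    (toFn (g.natDegree + 1) g, toFn (n - g.natDegree + 1) h) ∈
      factorPairs n g.natDegree (2 ^ n * (n + 1) * Q) := by
  have hg0 := left_ne_zero_of_mul hgh
  have hh0 := right_ne_zero_of_mul hgh
  have hdeg_add : g.natDegree + h.natDegree = n := by rw [← natDegree_mul hg0 hh0, hdeg]
  have hheight : (polyHeight g : ℝ) * polyHeight h ≤ 2 ^ n * (n + 1) * Q := by
    refine (polyHeight_mul_polyHeight_le hgh).trans ?_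
    rw [hdeg]
    gcongr
  have hg1 : 1 ≤ polyHeight g := polyHeight_pos hg0
  have hg_pos : (0 : ℝ) < polyHeight g := by exact_mod_cast hg1
  have hh1 : (1 : ℝ) ≤ polyHeight h := by exact_mod_cast polyHeight_pos hh0
  have hgX := (le_mul_of_one_le_right hg_pos.le hh1).trans hheight
  have hg_toFn : ofFn _ (toFn (g.natDegree + 1) g) = g :=
    ofFn_comp_toFn_eq_id_of_natDegree_lt (Nat.lt_succ_self _)
  have hh_toFn : ofFn _ (toFn (n - g.natDegree + 1) h) = h :=
    ofFn_comp_toFn_eq_id_of_natDegree_lt (by omega)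
  rw [factorPairs, Finset.mem_biUnion]
  refine ⟨polyHeight g, Finset.mem_Icc.2 ⟨hg1, Nat.le_floor hgX⟩, ?_⟩
  rw [Finset.mem_product, intSphere, Finset.mem_filter, ← polyHeight_ofFn_le_iff hg_pos.le,
    ← polyHeight_ofFn_le_iff (div_nonneg (hg_pos.le.trans hgX) hg_pos.le), hg_toFn, hh_toFn,
    le_div_iff₀' hg_pos]
  exact ⟨⟨le_rfl, rfl⟩, hheight⟩

lemma reducibleBox_subset {n : ℕ} {Q : ℝ} (hQ : 0 ≤ Q) :
    reducibleBox n Q ⊆ ((Finset.Icc 1 n).filter (2 * · ≤ n)).biUnion fun k =>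
      (factorPairs n k (2 ^ n * (n + 1) * Q)).image
        fun p => toFn (n + 1) (ofFn (k + 1) p.1 * ofFn (n - k + 1) p.2) := by
  intro a ha
  obtain ⟨ha, g, h, hgh, hg, hh, hdeg⟩ := Finset.mem_filter.1 ha
  wlog hle : g.natDegree ≤ h.natDegree generalizing g h
  · exact this h g (by rw [hgh, mul_comm]) hh hg (by omega) (by omega)
  have hg0 : g ≠ 0 := ne_zero_of_natDegree_gt hg
  have hh0 : h ≠ 0 := ne_zero_of_natDegree_gt hh
  have hmem := mk_toFn_mem_factorPairs (mul_ne_zero hg0 hh0)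
    ((natDegree_mul hg0 hh0).trans hdeg) (hgh ▸ (polyHeight_ofFn_le_iff hQ).2 ha)
  rw [Finset.mem_biUnion]
  refine ⟨g.natDegree, Finset.mem_filter.2 ⟨Finset.mem_Icc.2 ⟨hg, by omega⟩, by omega⟩,
    Finset.mem_image.2 ⟨_, hmem, ?_⟩⟩
  rw [ofFn_comp_toFn_eq_id_of_natDegree_lt (Nat.lt_succ_self _),
    ofFn_comp_toFn_eq_id_of_natDegree_lt (by omega), ← hgh]
  exact toFn_comp_ofFn_eq_id _ a

lemma card_reducibleBox_le_sum (n : ℕ) {Q : ℝ} (hQ : 0 ≤ Q) :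
    (reducibleBox n Q).card ≤ ∑ k ∈ (Finset.Icc 1 n).filter (2 * · ≤ n),
      (factorPairs n k (2 ^ n * (n + 1) * Q)).card :=
  (Finset.card_le_card (reducibleBox_subset hQ)).trans
    (Finset.card_biUnion_le.trans (Finset.sum_le_sum fun _ _ => Finset.card_image_le))

lemma exists_card_reducibleBox_le {n : ℕ} (hn : 2 ≤ n) : ∃ C : ℝ, 0 ≤ C ∧ ∀ Q : ℝ, 1 ≤ Q →
    ((reducibleBox n Q).card : ℝ) ≤ C * errorTerm n Q := by
  set c : ℝ := 2 ^ n * (n + 1)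
  have hc : 1 ≤ c := one_le_mul_of_one_le_of_one_le (one_le_pow₀ one_le_two) (by simp)
  set A : ℝ := 4 * (n + 1) * 3 ^ (n + 1)
  have herror_nonneg := errorTerm_nonneg n hc
  refine ⟨n * (A * errorTerm n c), by positivity, fun Q hQ => ?_⟩
  set J := (Finset.Icc 1 n).filter (2 * · ≤ n)
  have hcQ : 1 ≤ c * Q := one_le_mul_of_one_le_of_one_le hc hQ
  have herrorQ_nonneg := errorTerm_nonneg n hcQ
  have hJ : J.card ≤ n := (Finset.card_filter_le _ _).trans (by simp)
  calc ((reducibleBox n Q).card : ℝ) ≤ ∑ k ∈ J, ((factorPairs n k (c * Q)).card : ℝ) := by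
        rw [← Nat.cast_sum]
        exact Nat.cast_le.2 (card_reducibleBox_le_sum n (by linarith))
    _ ≤ ∑ _k ∈ J, A * errorTerm n (c * Q) := by
        refine Finset.sum_le_sum fun k hk => ?_
        obtain ⟨hk, hkn⟩ := Finset.mem_filter.1 hk
        exact card_factorPairs_le hn (Finset.mem_Icc.1 hk).1 hkn hcQ
    _ = J.card * (A * errorTerm n (c * Q)) := by rw [Finset.sum_const, nsmul_eq_mul]
    _ ≤ n * (A * (errorTerm n c * errorTerm n Q)) := by
        gcongr
        exact errorTerm_mul_le n hc hQ
    _ = _ := by ring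

/-! ### Minimal polynomials over the integers -/

section IsIntMinpoly

variable {x : ℝ} {p q : ℤ[X]}

lemma aeval_primPart_eq_zero (hp : p ≠ 0) (hx : aeval x p = 0) : aeval x p.primPart = 0 := by
  rw [p.eq_C_content_mul_primPart, map_mul, aeval_C, mul_eq_zero] at hx
  exact hx.resolve_left (by simpa [content_eq_zero_iff] using hp)

lemma exists_isIntMinpoly (hx : IsAlgebraic ℤ x) : ∃ p, IsIntMinpoly p x := by
  obtain ⟨q, ⟨hq, hqx⟩, hmin⟩ := WellFounded.has_min (measure natDegree).wf
    {q : ℤ[X] | q ≠ 0 ∧ aeval x q = 0} hx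
  refine ⟨q.primPart, q.primPart_ne_zero, aeval_primPart_eq_zero hq hqx, fun r hr hrx => ?_,
    q.isPrimitive_primPart⟩
  rw [natDegree_primPart]
  exact not_lt.1 (hmin r ⟨hr, hrx⟩)

lemma intMinpoly_spec (hx : IsAlgebraic ℤ x) : IsIntMinpoly (intMinpoly x) x := by
  rw [intMinpoly, dif_pos (exists_isIntMinpoly hx)]
  exact (exists_isIntMinpoly hx).choose_spec

namespace IsIntMinpoly

lemma isAlgebraic (hp : IsIntMinpoly p x) : IsAlgebraic ℤ x := ⟨p, hp.ne_zero, hp.root⟩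

lemma neg (hp : IsIntMinpoly p x) : IsIntMinpoly (-p) x where
  ne_zero := neg_ne_zero.2 hp.ne_zero
  root := by rw [map_neg, hp.root, neg_zero]
  minimal q hq hqx := natDegree_neg p ▸ hp.minimal q hq hqx
  primitive r hr := hp.primitive r ((dvd_neg).1 hr)

lemma associated_minpoly (hp : IsIntMinpoly p x) :
    Associated (minpoly ℚ x) (p.map (Int.castRingHom ℚ)) := by
  have hinj : Function.Injective (Int.castRingHom ℚ) := RingHom.injective_int _
  have hroot : aeval x (p.map (Int.castRingHom ℚ)) = 0 :=
    (aeval_map_algebraMap ℚ x p).trans hp.root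
  have hne : p.map (Int.castRingHom ℚ) ≠ 0 := (Polynomial.map_ne_zero_iff hinj).2 hp.ne_zero
  have hint : IsIntegral ℚ x := isAlgebraic_iff_isIntegral.1 ⟨_, hne, hroot⟩
  refine associated_of_dvd_of_natDegree_le (minpoly.dvd ℚ x hroot) hne ?_
  set s := IsLocalization.integerNormalization (nonZeroDivisors ℤ) (minpoly ℚ x)
  calc (p.map (Int.castRingHom ℚ)).natDegree = p.natDegree := natDegree_map_eq_of_injective hinj p
    _ ≤ s.natDegree := hp.minimal s
        (IsFractionRing.integerNormalization_eq_zero_iff.not.2 (minpoly.ne_zero hint))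
        (IsLocalization.integerNormalization_aeval_eq_zero _ _ (minpoly.aeval ℚ x))
    _ ≤ (minpoly ℚ x).natDegree :=
        natDegree_le_natDegree (Finset.sup_mono (IsLocalization.integerNormalization_support _ _))

lemma dvd (hp : IsIntMinpoly p x) (hqx : aeval x q = 0) : p ∣ q := by
  rw [IsPrimitive.Int.dvd_iff_map_cast_dvd_map_cast _ _ hp.primitive,
    ← hp.associated_minpoly.dvd_iff_dvd_left]
  exact minpoly.dvd ℚ x ((aeval_map_algebraMap ℚ x q).trans hqx)

lemma eq_or_eq_neg (hp : IsIntMinpoly p x) (hq : IsIntMinpoly q x) : p = q ∨ p = -q := by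
  obtain ⟨u, hu⟩ := (associated_of_dvd_dvd (hp.dvd hq.root) (hq.dvd hp.root)).symm
  obtain ⟨r, hr, hru⟩ := Polynomial.isUnit_iff.1 u.isUnit
  rcases Int.isUnit_iff.1 hr with rfl | rfl
  · exact Or.inl (by simp [← hu, ← hru])
  · exact Or.inr (by simp [← hu, ← hru])

lemma degree_eq (hp : IsIntMinpoly p x) : degree x = p.natDegree := by
  rcases (intMinpoly_spec hp.isAlgebraic).eq_or_eq_neg hp with h | h <;> rw [degree, h]
  exact natDegree_neg p

lemma height_eq (hp : IsIntMinpoly p x) : height x = polyHeight p := by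
  rcases (intMinpoly_spec hp.isAlgebraic).eq_or_eq_neg hp with h | h <;> rw [height, h]
  exact polyHeight_neg p

lemma mem_algNumbersLE_iff (hp : IsIntMinpoly p x) {n : ℕ} {Q : ℝ} :
    x ∈ algNumbersLE n Q ↔ p.natDegree = n ∧ (polyHeight p : ℝ) ≤ Q := by
  rw [← hp.degree_eq, ← hp.height_eq]
  exact ⟨fun h => ⟨h.1.2, h.2⟩, fun h => ⟨⟨hp.isAlgebraic, h.1⟩, h.2⟩⟩

lemma natDegree_pos (hp : IsIntMinpoly p x) : 0 < p.natDegree := by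
  by_contra! hdeg
  have hC := eq_C_of_natDegree_le_zero hdeg
  have hroot := hp.root
  rw [hC, aeval_C, eq_intCast, Int.cast_eq_zero] at hroot
  exact hp.ne_zero (by rw [hC, hroot, C_0])

end IsIntMinpoly

lemma exists_eq_mul_of_not_isIntMinpoly (hp : p.IsPrimitive) (hx : aeval x p = 0)
    (hmin : ¬IsIntMinpoly p x) : ∃ g h : ℤ[X], p = g * h ∧ 0 < g.natDegree ∧ 0 < h.natDegree := by
  obtain ⟨g, hg⟩ := exists_isIntMinpoly ⟨p, hp.ne_zero, hx⟩
  obtain ⟨h, rfl⟩ := hg.dvd hx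
  refine ⟨g, h, rfl, hg.natDegree_pos, Nat.pos_of_ne_zero fun hh => hmin ?_⟩
  have hdeg := natDegree_mul (left_ne_zero_of_mul hp.ne_zero) (right_ne_zero_of_mul hp.ne_zero)
  rw [hh, add_zero] at hdeg
  exact ⟨hp.ne_zero, hx, fun r hr hrx => hdeg ▸ hg.minimal r hr hrx, hp⟩

end IsIntMinpoly

/-! ### Counting algebraic numbers -/

lemma ofFn_intCast {m : ℕ} (a : Fin m → ℤ) :
    (ofFn m fun i => (a i : ℝ)) = (ofFn m a).map (Int.castRingHom ℝ) :=
  (ofFn_map (Int.castRingHom ℝ) a).symm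

lemma eval_ofFn_intCast {m : ℕ} (a : Fin m → ℤ) (x : ℝ) :
    (ofFn m fun i => (a i : ℝ)).eval x = aeval x (ofFn m a) := by
  rw [← eval_map_algebraMap]
  exact congrArg (eval x) (ofFn_intCast a)

/-- The pairs `⟨a, x⟩` of the coefficient vector `a` of a primitive integer polynomial of degree at
most `n` and height at most `Q`, and a root `x ∈ I` of this polynomial. -/
noncomputable def rootPairs (n : ℕ) (I : Set ℝ) (Q : ℝ) : Finset (Σ _ : Fin (n + 1) → ℤ, ℝ) :=
  ((intBox (n + 1) Q).filter fun a => (ofFn (n + 1) a).IsPrimitive).sigma fun a =>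
    (ofFn (n + 1) fun i => (a i : ℝ)).roots.toFinset.filter (· ∈ I)

/-- The pairs in `rootPairs n I Q` in which the polynomial has degree `n` and is a minimal
polynomial of the root. -/
noncomputable def minpolyPairs (n : ℕ) (I : Set ℝ) (Q : ℝ) : Finset (Σ _ : Fin (n + 1) → ℤ, ℝ) :=
  (rootPairs n I Q).filter fun p =>
    IsIntMinpoly (ofFn (n + 1) p.1) p.2 ∧ (ofFn (n + 1) p.1).natDegree = n

section pairs

variable {n : ℕ} {I : Set ℝ} {Q x : ℝ} {a : Fin (n + 1) → ℤ}

lemma card_rootPairs (n : ℕ) (I : Set ℝ) (Q : ℝ) :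
    ((rootPairs n I Q).card : ℝ) = primitiveCount (n + 1) I Q := by
  rw [rootPairs, Finset.card_sigma, Nat.cast_sum]
  rfl

lemma mk_mem_rootPairs : ⟨a, x⟩ ∈ rootPairs n I Q ↔ a ∈ intBox (n + 1) Q ∧
    (ofFn (n + 1) a).IsPrimitive ∧ x ∈ I ∧ aeval x (ofFn (n + 1) a) = 0 := by
  rw [rootPairs, Finset.mem_sigma, Finset.mem_filter, and_assoc]
  refine and_congr_right fun _ => and_congr_right fun hprim => ?_
  have hne : (ofFn (n + 1) fun i => (a i : ℝ)) ≠ 0 := by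
    rw [ofFn_intCast]
    exact (Polynomial.map_ne_zero_iff (RingHom.injective_int _)).2 hprim.ne_zero
  rw [mem_filter_roots hne, eval_ofFn_intCast]

lemma mk_mem_minpolyPairs (hQ : 0 ≤ Q) : ⟨a, x⟩ ∈ minpolyPairs n I Q ↔
    IsIntMinpoly (ofFn (n + 1) a) x ∧ x ∈ algNumbersLE n Q ∩ I := by
  rw [minpolyPairs, Finset.mem_filter, mk_mem_rootPairs, ← polyHeight_ofFn_le_iff hQ]
  constructor
  · rintro ⟨⟨hheight, -, hxI, -⟩, hmin, hdeg⟩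
    exact ⟨hmin, hmin.mem_algNumbersLE_iff.2 ⟨hdeg, hheight⟩, hxI⟩
  · rintro ⟨hmin, hx, hxI⟩
    obtain ⟨hdeg, hheight⟩ := hmin.mem_algNumbersLE_iff.1 hx
    exact ⟨⟨hheight, hmin.primitive, hxI, hmin.root⟩, hmin, hdeg⟩

lemma exists_ofFn_eq_intMinpoly (hx : x ∈ algNumbersLE n Q) :
    ∃ a : Fin (n + 1) → ℤ, ofFn (n + 1) a = intMinpoly x :=
  ⟨toFn (n + 1) (intMinpoly x), ofFn_comp_toFn_eq_id_of_natDegree_lt (Nat.lt_succ_of_le hx.1.2.le)⟩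

lemma finite_algNumbersLE (n : ℕ) (Q : ℝ) : (algNumbersLE n Q).Finite := by
  refine ((minpolyPairs n univ Q).image Sigma.snd).finite_toSet.subset fun x hx => ?_
  obtain ⟨a, ha⟩ := exists_ofFn_eq_intMinpoly hx
  have hQ : 0 ≤ Q := (Nat.cast_nonneg _).trans hx.2
  exact Finset.mem_coe.2 (Finset.mem_image.2 ⟨⟨a, x⟩, (mk_mem_minpolyPairs hQ).2
    ⟨ha ▸ intMinpoly_spec hx.1.1, hx, mem_univ x⟩, rfl⟩)

/- The two pairs are given by the two signs of the minimal polynomial. -/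
lemma card_filter_minpolyPairs_snd_eq (hx : x ∈ algNumbersLE n Q ∩ I) :
    ((minpolyPairs n I Q).filter fun p => p.2 = x).card = 2 := by
  have hQ : 0 ≤ Q := (Nat.cast_nonneg _).trans hx.1.2
  obtain ⟨a, ha⟩ := exists_ofFn_eq_intMinpoly hx.1
  have hmin : IsIntMinpoly (ofFn (n + 1) a) x := ha ▸ intMinpoly_spec hx.1.1.1
  have hfiber : ((minpolyPairs n I Q).filter fun p => p.2 = x) = {⟨a, x⟩, ⟨-a, x⟩} := by
    ext ⟨b, y⟩
    rw [Finset.mem_filter, mk_mem_minpolyPairs hQ, Finset.mem_insert, Finset.mem_singleton,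
      Sigma.mk.injEq, Sigma.mk.injEq, heq_eq_eq, ← or_and_right]
    refine and_congr_left ?_
    rintro rfl
    refine ⟨fun hb => ?_, ?_⟩
    · rcases hb.1.eq_or_eq_neg hmin with h | h
      · exact Or.inl (injective_ofFn _ h)
      · exact Or.inr (injective_ofFn _ (h.trans (map_neg _ a).symm))
    · rintro (rfl | rfl)
      · exact ⟨hmin, hx⟩
      · exact ⟨map_neg (ofFn (n + 1)) a ▸ hmin.neg, hx⟩
  have ha0 : a ≠ 0 := ofFn_eq_zero_iff.not.1 hmin.ne_zero
  rw [hfiber, Finset.card_pair]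
  exact fun h => ha0 (self_eq_neg.1 (Sigma.mk.inj h).1)

lemma card_minpolyPairs (hQ : 0 ≤ Q) (n : ℕ) (I : Set ℝ) :
    (minpolyPairs n I Q).card = 2 * countingFunction n Q I := by
  have hfin : (algNumbersLE n Q ∩ I).Finite := (finite_algNumbersLE n Q).inter_of_left I
  have hmaps : ∀ p ∈ minpolyPairs n I Q, p.2 ∈ hfin.toFinset := fun p hp =>
    hfin.mem_toFinset.2 ((mk_mem_minpolyPairs hQ).1 hp).2
  rw [Finset.card_eq_sum_card_fiberwise hmaps, countingFunction, ncard_eq_toFinset_card _ hfin,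
    Finset.sum_const_nat fun x hx => card_filter_minpolyPairs_snd_eq (hfin.mem_toFinset.1 hx),
    mul_comm]

lemma mem_union_reducibleBox (hmem : ⟨a, x⟩ ∈ rootPairs n I Q)
    (hnot : ¬(IsIntMinpoly (ofFn (n + 1) a) x ∧ (ofFn (n + 1) a).natDegree = n)) :
    a ∈ (intBox (n + 1) Q).filter (fun a => a (Fin.last n) = 0) ∪ reducibleBox n Q := by
  obtain ⟨hbox, hprim, -, hroot⟩ := mk_mem_rootPairs.1 hmem
  have hlt : (ofFn (n + 1) a).natDegree < n + 1 := ofFn_natDegree_lt (by omega) a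
  rw [Finset.mem_union]
  by_cases hdeg : (ofFn (n + 1) a).natDegree = n
  · obtain ⟨g, h, hgh, hg, hh⟩ :=
      exists_eq_mul_of_not_isIntMinpoly hprim hroot fun hmin => hnot ⟨hmin, hdeg⟩
    refine Or.inr (Finset.mem_filter.2 ⟨hbox, g, h, hgh, hg, hh, ?_⟩)
    rw [← natDegree_mul (ne_zero_of_natDegree_gt hg) (ne_zero_of_natDegree_gt hh), ← hgh, hdeg]
  · refine Or.inl (Finset.mem_filter.2 ⟨hbox, ?_⟩)
    rw [← ofFn_coeff_fin a (Fin.last n), Fin.val_last]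
    exact coeff_eq_zero_of_natDegree_lt (by omega)

lemma card_rootPairs_le_add (n : ℕ) (I : Set ℝ) (Q : ℝ) :
    (rootPairs n I Q).card ≤ (minpolyPairs n I Q).card +
      (n + 1) * ((intBox n Q).card + (reducibleBox n Q).card) := by
  set A := (intBox (n + 1) Q).filter (fun a => a (Fin.last n) = 0) ∪ reducibleBox n Q
  set roots := fun a : Fin (n + 1) → ℤ =>
    (ofFn (n + 1) fun i => (a i : ℝ)).roots.toFinset.filter (· ∈ I)
  have hsub : (rootPairs n I Q).filter (fun p => ¬(IsIntMinpoly (ofFn (n + 1) p.1) p.2 ∧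
      (ofFn (n + 1) p.1).natDegree = n)) ⊆ A.sigma roots := by
    intro p hp
    obtain ⟨hp, hnot⟩ := Finset.mem_filter.1 hp
    exact Finset.mem_sigma.2 ⟨mem_union_reducibleBox hp hnot, (Finset.mem_sigma.1 hp).2⟩
  have hA : A.card ≤ (intBox n Q).card + (reducibleBox n Q).card :=
    (Finset.card_union_le _ _).trans (Nat.add_le_add_right (card_filter_coord_eq_le Q _ 0) _)
  have hsigma : (A.sigma roots).card ≤ A.card * (n + 1) := by
    rw [Finset.card_sigma]
    exact Finset.sum_le_card_nsmul _ _ _ fun a _ => rootCount_ofFn_le I _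
  rw [← Finset.card_filter_add_card_filter_not (s := rootPairs n I Q)
    (fun p => IsIntMinpoly (ofFn (n + 1) p.1) p.2 ∧ (ofFn (n + 1) p.1).natDegree = n)]
  refine Nat.add_le_add_left ((Finset.card_le_card hsub).trans (hsigma.trans ?_)) _
  rw [mul_comm]
  exact Nat.mul_le_mul_left _ hA

end pairs

lemma abs_countingFunction_sub_primitiveCount_le {n : ℕ} {I : Set ℝ} {Q : ℝ} (hQ : 0 ≤ Q) :
    |2 * (countingFunction n Q I : ℝ) - primitiveCount (n + 1) I Q| ≤
      (n + 1) * ((intBox n Q).card + (reducibleBox n Q).card) := by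
  have hle : 2 * countingFunction n Q I ≤ (rootPairs n I Q).card :=
    card_minpolyPairs hQ n I ▸ Finset.card_filter_le _ _
  have hge := card_minpolyPairs hQ n I ▸ card_rootPairs_le_add n I Q
  rw [← card_rootPairs, abs_sub_comm, abs_of_nonneg (sub_nonneg.2 (by exact_mod_cast hle)),
    sub_le_iff_le_add']
  exact_mod_cast hge

/-- The constant `c(I)` in the asymptotic formula `Φ_n(Q, I) ∼ c(I) Q ^ (n + 1)`. The factor `1 / 2`
accounts for the two signs of a minimal polynomial. -/
noncomputable def countingDensity (n : ℕ) (I : Set ℝ) : ℝ :=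
  primitiveDensity (n + 1) / 2 * rootVolume (n + 1) I

lemma countingDensity_nonneg {n : ℕ} (hn : n ≠ 0) (I : Set ℝ) : 0 ≤ countingDensity n I :=
  mul_nonneg (half_pos (primitiveDensity_pos (by omega))).le (rootVolume_nonneg _ _)

lemma countingDensity_univ_pos {n : ℕ} (hn : n ≠ 0) : 0 < countingDensity n univ :=
  mul_pos (half_pos (primitiveDensity_pos (by omega))) (rootVolume_univ_pos hn)

lemma countingDensity_le_univ {n : ℕ} (hn : n ≠ 0) {I : Set ℝ} (hI : I.OrdConnected) :
    countingDensity n I ≤ countingDensity n univ :=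
  mul_le_mul_of_nonneg_left (rootVolume_le_univ n hI)
    (half_pos (primitiveDensity_pos (by omega))).le

lemma countingDensity_div {n : ℕ} (hn : n ≠ 0) (I J : Set ℝ) :
    countingDensity n I / countingDensity n J = rootVolume (n + 1) I / rootVolume (n + 1) J :=
  mul_div_mul_left _ _ (half_pos (primitiveDensity_pos (by omega))).ne'

lemma exists_abs_countingFunction_sub_le {n : ℕ} (hn : 2 ≤ n) : ∃ C : ℝ, 0 ≤ C ∧
    ∀ I : Set ℝ, I.OrdConnected → ∀ Q : ℝ, 1 ≤ Q →
      |(countingFunction n Q I : ℝ) - countingDensity n I * Q ^ (n + 1)| ≤ C * errorTerm n Q := by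
  obtain ⟨C₁, hC₁, hprim⟩ := exists_abs_primitiveCount_sub_le hn
  obtain ⟨C₂, hC₂, hred⟩ := exists_card_reducibleBox_le hn
  refine ⟨((n + 1) * (3 ^ n + C₂) + C₁) / 2, by positivity, fun I hI Q hQ => ?_⟩
  have hpow := pow_le_errorTerm n hQ
  have hbox : ((intBox n Q).card : ℝ) ≤ 3 ^ n * errorTerm n Q := by
    refine (card_intBox_le n hQ).trans ?_
    rw [mul_pow]
    gcongr
  have htwice := calc
    |2 * (countingFunction n Q I : ℝ) -
        primitiveDensity (n + 1) * rootVolume (n + 1) I * Q ^ (n + 1)|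
      ≤ (n + 1) * ((intBox n Q).card + (reducibleBox n Q).card) + C₁ * Q ^ n :=
        (abs_sub_le _ (primitiveCount (n + 1) I Q) _).trans (add_le_add
          (abs_countingFunction_sub_primitiveCount_le (by linarith)) (hprim I hI Q (by linarith)))
    _ ≤ (n + 1) * (3 ^ n * errorTerm n Q + C₂ * errorTerm n Q) + C₁ * errorTerm n Q := by
        gcongr
        exact hred Q hQ
  rw [abs_le] at htwice ⊢
  rw [countingDensity]
  constructor <;> linarith [htwice.1, htwice.2]

/-! ### The distribution function -/

section distribution

variable {n : ℕ} {I : Set ℝ}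

lemma tendsto_countingFunction_div (hn : 2 ≤ n) (hI : I.OrdConnected) :
    Tendsto (fun Q : ℝ => (countingFunction n Q I : ℝ) / Q ^ (n + 1)) atTop
      (𝓝 (countingDensity n I)) := by
  obtain ⟨C, -, hcount⟩ := exists_abs_countingFunction_sub_le hn
  have herror : Tendsto (fun Q => C * (errorTerm n Q / Q ^ (n + 1))) atTop (𝓝 0) := by
    simpa only [mul_zero] using (tendsto_errorTerm_div n).const_mul C
  rw [tendsto_iff_norm_sub_tendsto_zero]
  refine squeeze_zero' (Eventually.of_forall fun _ => norm_nonneg _) ?_ herror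
  filter_upwards [eventually_ge_atTop 1] with Q hQ
  have hpow : 0 < Q ^ (n + 1) := by positivity
  rw [Real.norm_eq_abs, div_sub' hpow.ne', abs_div, abs_of_pos hpow, ← mul_div_assoc,
    mul_comm (Q ^ (n + 1))]
  gcongr
  exact hcount I hI Q hQ

lemma tendsto_proportion (hn : 2 ≤ n) (x : ℝ) : Tendsto (proportion n x) atTop
    (𝓝 (rootVolume (n + 1) (Iic x) / rootVolume (n + 1) univ)) := by
  have hquotient := (tendsto_countingFunction_div hn (ordConnected_Iic (a := x))).div
    (tendsto_countingFunction_div hn ordConnected_univ)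
    (countingDensity_univ_pos (by omega)).ne'
  rw [countingDensity_div (by omega)] at hquotient
  refine hquotient.congr' ?_
  filter_upwards [eventually_ge_atTop 1] with Q hQ
  exact div_div_div_cancel_right₀ (by positivity) _ _

lemma distributionFunction_eq (hn : 2 ≤ n) (x : ℝ) : distributionFunction n x =
    rootVolume (n + 1) (Iic x) / rootVolume (n + 1) univ :=
  (tendsto_proportion hn x).limUnder_eq

lemma hasDerivAt_distributionFunction (hn : 2 ≤ n) (x : ℝ) :
    HasDerivAt (distributionFunction n) (rootDensity n x / rootVolume (n + 1) univ) x := by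
  rw [funext (distributionFunction_eq hn)]
  exact (hasDerivAt_rootVolume_Iic n x).div_const _

lemma distributionDensity_eq (hn : 2 ≤ n) :
    distributionDensity n = fun x => rootDensity n x / rootVolume (n + 1) univ :=
  funext fun x => (hasDerivAt_distributionFunction hn x).deriv

lemma integrable_distributionDensity (hn : 2 ≤ n) : Integrable (distributionDensity n) :=
  distributionDensity_eq hn ▸ (integrable_rootDensity n).div_const _

lemma setIntegral_distributionDensity (hn : 2 ≤ n) (hI : I.OrdConnected) :
    ∫ x in I, distributionDensity n x = countingDensity n I / countingDensity n univ := by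
  rw [distributionDensity_eq hn, integral_div, setIntegral_rootDensity hI,
    countingDensity_div (by omega)]

end distribution

/-! ### Sequences ordered by height -/

section ordering

variable {n : ℕ} {α : ℕ → ℝ}

namespace IsHeightOrdering

lemma monotone_height (hα : IsHeightOrdering n α) : Monotone fun i => height (α i) :=
  monotone_nat_of_le_succ hα.height_le

lemma mem_algNumbers (hα : IsHeightOrdering n α) (i : ℕ) : α i ∈ algNumbers n :=
  hα.range_eq ▸ mem_range_self i

lemma one_le_height (hα : IsHeightOrdering n α) (i : ℕ) : 1 ≤ height (α i) :=
  polyHeight_pos (intMinpoly_spec (hα.mem_algNumbers i).1).ne_zero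

lemma countFirst_eq_ncard_image (hα : IsHeightOrdering n α) (N : ℕ) (S : Set ℝ) :
    countFirst α N S = (α '' {i | i < N ∧ α i ∈ S}).ncard :=
  (ncard_image_of_injective _ hα.injective).symm

lemma countFirst_succ_le (hα : IsHeightOrdering n α) (N : ℕ) (S : Set ℝ) :
    countFirst α (N + 1) S ≤ countingFunction n (height (α N)) S := by
  rw [hα.countFirst_eq_ncard_image, countingFunction]
  refine ncard_le_ncard ?_ ((finite_algNumbersLE n _).subset inter_subset_left)
  rintro _ ⟨i, ⟨hi, hiS⟩, rfl⟩
  exact ⟨⟨hα.mem_algNumbers i, by exact_mod_cast hα.monotone_height (Nat.lt_succ_iff.1 hi)⟩, hiS⟩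

lemma countingFunction_le_countFirst_succ (hα : IsHeightOrdering n α) (N : ℕ) (S : Set ℝ) :
    countingFunction n ((height (α N) : ℝ) - 1) S ≤ countFirst α (N + 1) S := by
  rw [hα.countFirst_eq_ncard_image, countingFunction]
  refine ncard_le_ncard ?_ (((finite_lt_nat (N + 1)).subset fun _ hi => hi.1).image α)
  rintro x ⟨⟨hx, hheight⟩, hxS⟩
  rw [← hα.range_eq] at hx
  obtain ⟨i, rfl⟩ := hx
  refine ⟨i, ⟨?_, hxS⟩, rfl⟩
  by_contra! hi
  have hle : (height (α N) : ℝ) ≤ height (α i) := by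
    exact_mod_cast hα.monotone_height (show N ≤ i by omega)
  linarith

end IsHeightOrdering

lemma countFirst_univ (α : ℕ → ℝ) (N : ℕ) : countFirst α N univ = N := by
  rw [countFirst, show {i | i < N ∧ α i ∈ univ} = Iio N by ext i; simp, ← Finset.coe_Iio,
    ncard_coe_finset, Nat.card_Iio]

lemma pow_succ_sub_pow_succ_le (n : ℕ) {Q : ℝ} (hQ : 1 ≤ Q) :
    Q ^ (n + 1) - (Q - 1) ^ (n + 1) ≤ (n + 1) * Q ^ n := by
  have hbernoulli := one_add_mul_le_pow (a := -Q⁻¹)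
    (by linarith [inv_le_one_of_one_le₀ hQ]) (n + 1)
  have hQ0 : Q ≠ 0 := by positivity
  have hfactor : Q - 1 = Q * (1 + -Q⁻¹) := by
    field_simp
    ring
  calc Q ^ (n + 1) - (Q - 1) ^ (n + 1) = Q ^ (n + 1) * (1 - (1 + -Q⁻¹) ^ (n + 1)) := by
        rw [hfactor, mul_pow]
        ring
    _ ≤ Q ^ (n + 1) * ((n + 1) * Q⁻¹) := by
        push_cast at hbernoulli
        gcongr
        linarith
    _ = (n + 1) * Q ^ n := by
        field_simp
        ring

lemma IsHeightOrdering.sub_le_countFirst_succ (hα : IsHeightOrdering n α) {I : Set ℝ} {c C : ℝ}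
    (hC : 0 ≤ C)
    (hcount : ∀ Q : ℝ, 1 ≤ Q → |countingFunction n Q I - c * Q ^ (n + 1)| ≤ C * errorTerm n Q)
    (N : ℕ) : c * ((height (α N) : ℝ) - 1) ^ (n + 1) - C * errorTerm n (height (α N)) ≤
      countFirst α (N + 1) I := by
  have hlower : (countingFunction n ((height (α N) : ℝ) - 1) I : ℝ) ≤ countFirst α (N + 1) I := by
    exact_mod_cast hα.countingFunction_le_countFirst_succ N I
  rcases (hα.one_le_height N).eq_or_lt with hone | htwo
  · rw [← hone, Nat.cast_one, sub_self, zero_pow n.succ_ne_zero, mul_zero, zero_sub]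
    exact (neg_nonpos.2 (mul_nonneg hC (errorTerm_nonneg n le_rfl))).trans (Nat.cast_nonneg _)
  · have htwo : (2 : ℝ) ≤ height (α N) := by exact_mod_cast htwo
    have hmono : C * errorTerm n ((height (α N) : ℝ) - 1) ≤ C * errorTerm n (height (α N)) :=
      mul_le_mul_of_nonneg_left (errorTerm_mono n (by linarith) (by linarith)) hC
    linarith [(abs_le.1 (hcount (height (α N) - 1) (by linarith))).1]

lemma exists_abs_countFirst_succ_sub_le (hn : 2 ≤ n) : ∃ C : ℝ, 0 ≤ C ∧
    ∀ α : ℕ → ℝ, IsHeightOrdering n α → ∀ I : Set ℝ, I.OrdConnected → ∀ N : ℕ,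
      |(countFirst α (N + 1) I : ℝ) - countingDensity n I * (height (α N) : ℝ) ^ (n + 1)| ≤
        C * errorTerm n (height (α N)) := by
  obtain ⟨C, hC, hcount⟩ := exists_abs_countingFunction_sub_le hn
  have htotal := countingDensity_univ_pos (n := n) (by omega)
  refine ⟨C + countingDensity n univ * (n + 1), by positivity, fun α hα I hI N => ?_⟩
  have hQ : (1 : ℝ) ≤ height (α N) := by exact_mod_cast hα.one_le_height N
  have hupper : (countFirst α (N + 1) I : ℝ) ≤ countingFunction n (height (α N)) I := by
    exact_mod_cast hα.countFirst_succ_le N I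
  have hlower := hα.sub_le_countFirst_succ hC (hcount I hI) N
  have hcountQ := (abs_le.1 (hcount I hI _ hQ)).2
  generalize (height (α N) : ℝ) = Q at *
  have herror := errorTerm_nonneg n hQ
  have hgap : countingDensity n I * (Q ^ (n + 1) - (Q - 1) ^ (n + 1)) ≤
      countingDensity n univ * (n + 1) * errorTerm n Q := calc
    _ ≤ countingDensity n univ * ((n + 1) * Q ^ n) :=
        mul_le_mul (countingDensity_le_univ (by omega) hI) (pow_succ_sub_pow_succ_le n hQ)
          (sub_nonneg.2 (pow_le_pow_left₀ (by linarith) (by linarith) _)) htotal.le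
    _ ≤ countingDensity n univ * ((n + 1) * errorTerm n Q) := by
        gcongr
        exact pow_le_errorTerm n hQ
    _ = _ := by ring
  have hgap_nonneg : 0 ≤ countingDensity n univ * (n + 1) * errorTerm n Q := by positivity
  rw [abs_le, add_mul]
  constructor <;> linarith

lemma exists_abs_countFirst_succ_sub_integral_le_errorTerm (hn : 2 ≤ n) : ∃ C : ℝ, 0 ≤ C ∧
    ∀ α : ℕ → ℝ, IsHeightOrdering n α → ∀ I : Set ℝ, I.OrdConnected → ∀ N : ℕ,
      |(countFirst α (N + 1) I : ℝ) - (N + 1) * ∫ x in I, distributionDensity n x| ≤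
        C * errorTerm n (height (α N)) := by
  obtain ⟨C, hC, hfirst⟩ := exists_abs_countFirst_succ_sub_le hn
  refine ⟨2 * C, by positivity, fun α hα I hI N => ?_⟩
  have htotal := countingDensity_univ_pos (n := n) (by omega)
  have hI_first := hfirst α hα I hI N
  have huniv_first := hfirst α hα univ ordConnected_univ N
  rw [countFirst_univ, Nat.cast_succ] at huniv_first
  rw [setIntegral_distributionDensity hn hI]
  set r := countingDensity n I / countingDensity n univ with hr
  have hr_nonneg : 0 ≤ r := div_nonneg (countingDensity_nonneg (by omega) I) htotal.le
  have hr_le_one : r ≤ 1 := (div_le_one htotal).2 (countingDensity_le_univ (by omega) hI)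
  rw [← div_mul_cancel₀ (countingDensity n I) htotal.ne', ← hr] at hI_first
  generalize (height (α N) : ℝ) = Q at *
  calc |(countFirst α (N + 1) I : ℝ) - (N + 1) * r|
      = |(countFirst α (N + 1) I - r * countingDensity n univ * Q ^ (n + 1)) -
          r * (N + 1 - countingDensity n univ * Q ^ (n + 1))| := by ring_nf
    _ ≤ |countFirst α (N + 1) I - r * countingDensity n univ * Q ^ (n + 1)| +
          r * |N + 1 - countingDensity n univ * Q ^ (n + 1)| := by
        rw [← abs_of_nonneg hr_nonneg, ← abs_mul, abs_of_nonneg hr_nonneg]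
        exact abs_sub _ _
    _ ≤ C * errorTerm n Q + 1 * (C * errorTerm n Q) :=
        add_le_add hI_first (mul_le_mul hr_le_one huniv_first (abs_nonneg _) zero_le_one)
    _ = 2 * C * errorTerm n Q := by ring

end ordering

/-! ### From heights to indices -/

lemma exists_pow_succ_le_mul (n : ℕ) {c : ℝ} (hc : 0 < c) (C : ℝ) :
    ∃ A : ℝ, 1 ≤ A ∧ ∀ N Q : ℝ, 1 ≤ N → 1 ≤ Q →
      c * Q ^ (n + 1) - C * errorTerm n Q ≤ N → Q ^ (n + 1) ≤ A * N := by
  have hlimit : Tendsto (fun Q => C * (errorTerm n Q / Q ^ (n + 1))) atTop (𝓝 0) := by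
    simpa only [mul_zero] using (tendsto_errorTerm_div n).const_mul C
  obtain ⟨Q₀, hQ₀⟩ := eventually_atTop.1 (hlimit.eventually_lt_const (half_pos hc))
  refine ⟨max (max 1 (2 / c)) (|Q₀| ^ (n + 1)), le_max_of_le_left (le_max_left _ _),
    fun N Q hN hQ hle => ?_⟩
  rcases le_or_gt Q₀ Q with hlarge | hsmall
  · have herror := hQ₀ Q hlarge
    rw [← mul_div_assoc, div_lt_iff₀ (by positivity)] at herror
    calc Q ^ (n + 1) ≤ 2 / c * N := by
          rw [div_mul_eq_mul_div, le_div_iff₀ hc]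
          linarith
      _ ≤ _ := by
          gcongr
          exact le_max_of_le_left (le_max_right _ _)
  · calc Q ^ (n + 1) ≤ |Q₀| ^ (n + 1) * 1 := by
          rw [mul_one]
          gcongr
          exact hsmall.le.trans (le_abs_self _)
      _ ≤ _ := mul_le_mul (le_max_right _ _) hN zero_le_one (by positivity)

lemma pow_le_mul_rpow_of_pow_succ_le {n : ℕ} {A N Q : ℝ} (hA : 1 ≤ A) (hN : 0 ≤ N) (hQ : 0 ≤ Q)
    (h : Q ^ (n + 1) ≤ A * N) : Q ^ n ≤ A * N ^ ((n : ℝ) / ((n : ℝ) + 1)) := by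
  have hexp : (n : ℝ) / ((n : ℝ) + 1) ≤ 1 := (div_le_one (by positivity)).2 (by linarith)
  calc Q ^ n = (Q ^ (n + 1)) ^ ((n : ℝ) / ((n : ℝ) + 1)) := by
        rw [← Real.rpow_natCast Q (n + 1), ← Real.rpow_mul hQ, ← Real.rpow_natCast Q n]
        congr 1
        push_cast
        field_simp
    _ ≤ (A * N) ^ ((n : ℝ) / ((n : ℝ) + 1)) := by gcongr
    _ = A ^ ((n : ℝ) / ((n : ℝ) + 1)) * N ^ ((n : ℝ) / ((n : ℝ) + 1)) :=
        Real.mul_rpow (by linarith) hN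
    _ ≤ A * N ^ ((n : ℝ) / ((n : ℝ) + 1)) := by
        gcongr
        exact Real.rpow_le_self_of_one_le hA hexp

lemma one_add_log_le_mul_log {A N Q : ℝ} (hA : 1 ≤ A) (hN : 2 ≤ N) (hQ : 0 < Q) (h : Q ≤ A * N) :
    1 + Real.log Q ≤ ((1 + Real.log A) / Real.log 2 + 1) * Real.log N := by
  have hlog_two : 0 < Real.log 2 := Real.log_pos one_lt_two
  have hlogA := Real.log_nonneg hA
  have hlogQ : Real.log Q ≤ Real.log A + Real.log N := by
    rw [← Real.log_mul (by linarith) (by linarith)]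
    exact Real.log_le_log hQ h
  have hconst : 1 + Real.log A ≤ (1 + Real.log A) / Real.log 2 * Real.log N := by
    rw [div_mul_eq_mul_div, le_div_iff₀ hlog_two]
    gcongr
  linarith

lemma errorTerm_le_of_pow_succ_le {n : ℕ} {A N Q : ℝ} (hA : 1 ≤ A) (hN : 2 ≤ N) (hQ : 1 ≤ Q)
    (h : Q ^ (n + 1) ≤ A * N) : errorTerm n Q ≤ A * ((1 + Real.log A) / Real.log 2 + 1) ^ ell n *
      (N ^ ((n : ℝ) / ((n : ℝ) + 1)) * Real.log N ^ ell n) := by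
  have hlogQ := Real.log_nonneg hQ
  calc errorTerm n Q ≤ (A * N ^ ((n : ℝ) / ((n : ℝ) + 1))) *
        (((1 + Real.log A) / Real.log 2 + 1) * Real.log N) ^ ell n := by
        rw [errorTerm]
        gcongr
        · exact pow_le_mul_rpow_of_pow_succ_le hA (by linarith) (by linarith) h
        · exact one_add_log_le_mul_log hA hN (by linarith)
            ((le_self_pow₀ hQ n.succ_ne_zero).trans h)
    _ = _ := by
        rw [mul_pow]
        ring

lemma exists_errorTerm_height_le {n : ℕ} (hn : 2 ≤ n) : ∃ C : ℝ,
    ∀ α : ℕ → ℝ, IsHeightOrdering n α → ∀ N : ℕ, 1 ≤ N → errorTerm n (height (α N)) ≤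
      C * (((N : ℝ) + 1) ^ ((n : ℝ) / ((n : ℝ) + 1)) * Real.log (N + 1) ^ ell n) := by
  obtain ⟨C, -, hfirst⟩ := exists_abs_countFirst_succ_sub_le hn
  have htotal := countingDensity_univ_pos (n := n) (by omega)
  obtain ⟨A, hA, hpow⟩ := exists_pow_succ_le_mul n htotal C
  refine ⟨A * ((1 + Real.log A) / Real.log 2 + 1) ^ ell n, fun α hα N hN => ?_⟩
  have hQ : (1 : ℝ) ≤ height (α N) := by exact_mod_cast hα.one_le_height N
  have hN : (1 : ℝ) ≤ N := by exact_mod_cast hN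
  have hcount := (abs_le.1 (hfirst α hα univ ordConnected_univ N)).1
  rw [countFirst_univ, Nat.cast_succ] at hcount
  exact errorTerm_le_of_pow_succ_le hA (by linarith) hQ
    (hpow _ _ (by linarith) hQ (by linarith))

lemma exists_abs_countFirst_sub_integral_le {n : ℕ} (hn : 2 ≤ n) : ∃ C : ℝ,
    ∀ α : ℕ → ℝ, IsHeightOrdering n α → ∀ I : Set ℝ, I.OrdConnected → ∀ N : ℕ, 2 ≤ N →
      |(countFirst α N I : ℝ) - N * ∫ x in I, distributionDensity n x| ≤
        C * ((N : ℝ) ^ ((n : ℝ) / ((n : ℝ) + 1)) * Real.log N ^ ell n) := by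
  obtain ⟨C, hC, hcount⟩ := exists_abs_countFirst_succ_sub_integral_le_errorTerm hn
  obtain ⟨B, herror⟩ := exists_errorTerm_height_le hn
  refine ⟨C * B, fun α hα I hI N hN => ?_⟩
  obtain ⟨N, rfl⟩ := Nat.exists_eq_succ_of_ne_zero (show N ≠ 0 by omega)
  rw [Nat.cast_succ, mul_assoc]
  exact (hcount α hα I hI N).trans
    (mul_le_mul_of_nonneg_left (herror α hα N (by omega)) hC)

end RealAlgDist

theorem mainTheorem3 (n : ℕ) (hn : 2 ≤ n) :
    (∀ x : ℝ, Tendsto (RealAlgDist.proportion n x) atTop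
      (𝓝 (RealAlgDist.distributionFunction n x))) ∧
    (∀ x : ℝ, HasDerivAt (RealAlgDist.distributionFunction n)
      (RealAlgDist.distributionDensity n x) x) ∧
    MeasureTheory.Integrable (RealAlgDist.distributionDensity n) ∧
    ∃ C : ℝ, ∀ α : ℕ → ℝ, RealAlgDist.IsHeightOrdering n α →
      ∀ I : Set ℝ, I.OrdConnected → ∀ N : ℕ, 2 ≤ N →
        |(RealAlgDist.countFirst α N I : ℝ) - N * ∫ x in I, RealAlgDist.distributionDensity n x| ≤
          C * ((N : ℝ) ^ ((n : ℝ) / ((n : ℝ) + 1)) * Real.log N ^ RealAlgDist.ell n) := by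
  open RealAlgDist in
  refine ⟨fun x => ?_, fun x => ?_, integrable_distributionDensity hn,
    exists_abs_countFirst_sub_integral_le hn⟩
  · rw [distributionFunction_eq hn]
    exact tendsto_proportion hn x
  · exact (hasDerivAt_distributionFunction hn x).differentiableAt.hasDerivAt
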